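/- Let $P\subset\mathbf R^n$ be a nonempty convex polytope of dimension $d$ (a $d$-polytope). For $S\subseteq\{0,\dots,d-1\}$ let $f_S(P)$ be the number of chains of nonempty faces of $P$ with exactly one face of dimension $s$ for each $s\in S$ and no others, let $h_S(P)=\sum_{T\subseteq S}(-1)^{|S|-|T|}f_T(P)$, and let $\Psi(P)=\sum_{S}h_S(P)\,w_S$ be the $\mathbf{ab}$-index, where $w_S=w_0\cdots w_{d-1}$ is the word in noncommuting indeterminates with $w_i=\mathbf b$ if $i\in S$ and $w_i=\mathbf a$ otherwise. There is exactly one noncommutative polynomial $\Phi(P)$ with integer coefficients in $\mathbf c,\mathbf d$, the $\mathbf{cd}$-index of $P$, that becomes $\Psi(P)$ under $\mathbf c=\mathbf a+\mathbf b$, $\mathbf d=\mathbf{ab}+\mathbf{ba}$; put $\Phi(\emptyset)=0$. A sweep consists of a vector $p\in\mathbf R^n$ and a choice, for polytopes $P$ and vertices $v$ of $P$, of a hyperplane truncating $v$. The vertex figure $Q_v$ is the intersection of $P$ with the hyperplane truncating $v$ in $P$. Let $H_v=\{x:p\cdot x=p\cdot v\}$, $H_v^+=\{x:p\cdot x>p\cdot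 v\}$ and $R_v=Q_v\cap H_v$ (possibly empty). The sweep is generic for $P$ if $d=0$, or if $d>0$, the values $p\cdot v$ at the vertices $v$ of $P$ are pairwise distinct, and for every vertex $v$ of $P$ the hyperplane truncating $v$ strictly separates $v$ from all the other vertices of $P$ and the sweep is (recursively) generic for the $(d-1)$-polytope $Q_v$. For a sweep that is generic for $P$, each vertex $v$ of $P$ is assigned a polynomial $\Phi_v(P)$ in $\mathbf c,\mathbf d$ by recursion on $d$, as given by the formulas for $\Phi_v(P)$ in (1) and (2). Then: 1. If $d=0$, then $P$ has exactly one vertex $v$, and $\Phi_v(P)=\Phi(P)=1$. 2. If $d>0$, then $$\Phi_v(P)=\mathbf d\,\Phi(R_v)+\sum_{w\in\mathrm{vert}(Q_v)\cap H_v^+}\mathbf c\,\Phi_w(Q_v)\qquad(v\in\mathrm{vert}(P)),$$ and $$\Phi(P)=\sum_{v\in\mathrm{vert}(P)}\Phi_v(P).$$ -/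

import Mathlib

open scoped RealInnerProductSpace

noncomputable section

namespace CDSweep

section Polytopes

variable {E : Type*} [NormedAddCommGroup E] [InnerProductSpace ℝ E]

/-- A (nonempty) convex polytope: the convex hull of a nonempty finite set of points. -/
def IsPolytope (P : Set E) : Prop :=
  P.Nonempty ∧ ∃ s : Finset E, P = convexHull ℝ (s : Set E)

/-- The dimension of the affine hull (only meaningful for nonempty sets). -/
def dim (P : Set E) : ℕ :=
  Module.finrank ℝ (affineSpan ℝ P).direction

/-- The vertices of a polytope. -/
def vert (P : Set E) : Set E :=
  P.extremePoints ℝ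

/-- The nonempty faces of a polytope: the set where some linear functional is maximal on `P`. -/
def IsFace (P F : Set E) : Prop :=
  IsExposed ℝ P F ∧ F.Nonempty

/-- The set of `S`-chains of `P`: strictly increasing families of faces `F s`, `s ∈ S`,
with `F s` of dimension `s`. -/
def chains (P : Set E) (S : Finset ℕ) : Set (S → Set E) :=
  {F | StrictMono F ∧ ∀ s : S, IsFace P (F s) ∧ dim (F s) = (s : ℕ)}

/-- The entry `f_S` of the flag `f`-vector. -/
def flagF (P : Set E) (S : Finset ℕ) : ℕ :=
  (chains P S).ncard

/-- The entry `h_S` of the flag `h`-vector. -/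
def flagH (P : Set E) (S : Finset ℕ) : ℤ :=
  ∑ T ∈ S.powerset, (-1) ^ (S.card - T.card) * (flagF P T : ℤ)

end Polytopes

/-- The two noncommuting indeterminates `a`, `b`. -/
inductive AB : Type
  | a
  | b

/-- The two noncommuting indeterminates `c`, `d`. -/
inductive CD : Type
  | c
  | d

/-- Noncommutative polynomials in `a`, `b` with integer coefficients. -/
abbrev ABPoly : Type := FreeAlgebra ℤ AB

/-- Noncommutative polynomials in `c`, `d` with integer coefficients. -/
abbrev CDPoly : Type := FreeAlgebra ℤ CD

/-- The indeterminate `a`. -/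
def a : ABPoly := FreeAlgebra.ι ℤ AB.a

/-- The indeterminate `b`. -/
def b : ABPoly := FreeAlgebra.ι ℤ AB.b

/-- The indeterminate `c`. -/
def c : CDPoly := FreeAlgebra.ι ℤ CD.c

/-- The indeterminate `d`. -/
def d : CDPoly := FreeAlgebra.ι ℤ CD.d

/-- The substitution `c = a + b`, `d = ab + ba`. -/
def cdToAB : CDPoly →ₐ[ℤ] ABPoly :=
  FreeAlgebra.lift ℤ fun x : CD =>
    match x with
    | CD.c => a + b
    | CD.d => a * b + b * a

open Classical in
/-- The word `w_0 ⋯ w_{k-1}` with `w_i = b` if `i ∈ S` and `w_i = a` otherwise. -/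
def abWord (k : ℕ) (S : Finset ℕ) : ABPoly :=
  ((List.range k).map fun i => if i ∈ S then b else a).prod

section Sweeping

variable {E : Type*} [NormedAddCommGroup E] [InnerProductSpace ℝ E]

/-- The `ab`-index of a polytope. -/
def abIndex (P : Set E) : ABPoly :=
  ∑ S ∈ (Finset.range (dim P)).powerset, flagH P S • abWord (dim P) S

open Classical in
/-- The `cd`-index: the polynomial in `c`, `d` that becomes the `ab`-index under
`c = a + b`, `d = ab + ba`; the `cd`-index of the empty set is `0` by convention.
(The value `0` in the remaining case is never taken by a polytope.) -/
def cdIndex (P : Set E) : CDPoly :=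
  if h : P.Nonempty ∧ ∃ φ : CDPoly, cdToAB φ = abIndex P then h.2.choose else 0

/-- The data of a sweep: the sweeping direction `p`, and for each polytope `P` and vertex `v`
a hyperplane `{x | ⟪normal P v, x⟫ = level P v}` used to truncate `v`. -/
structure Sweep (E : Type*) [NormedAddCommGroup E] [InnerProductSpace ℝ E] where
  /-- The sweeping direction `p`. -/
  p : E
  /-- The normal vector of the hyperplane truncating `v` in `P`. -/
  normal : Set E → E → E
  /-- The right-hand side of the equation of the hyperplane truncating `v` in `P`. -/
  level : Set E → E → ℝ

namespace Sweep

variable (σ : Sweep E)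

/-- The truncating hyperplane strictly separates `v` from all the other vertices of `P`. -/
def Truncates (P : Set E) (v : E) : Prop :=
  ⟪σ.normal P v, v⟫ < σ.level P v ∧
    ∀ u ∈ vert P, u ≠ v → σ.level P v < ⟪σ.normal P v, u⟫

/-- The vertex figure `Q_v` of `P` at `v`. -/
def Q (P : Set E) (v : E) : Set E :=
  P ∩ {x | ⟪σ.normal P v, x⟫ = σ.level P v}

/-- The section `R_v = Q_v ∩ H_v`, where `H_v` is the sweeping hyperplane through `v`. -/
def R (P : Set E) (v : E) : Set E :=
  σ.Q P v ∩ {x | ⟪σ.p, x⟫ = ⟪σ.p, v⟫}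

/-- The open halfspace `H_v^+` above the sweeping hyperplane through `v`. -/
def upper (v : E) : Set E :=
  {x | ⟪σ.p, v⟫ < ⟪σ.p, x⟫}

/-- Genericity for a `k`-polytope, by recursion on `k`. -/
def GenericAux : ℕ → Set E → Prop
  | 0, _ => True
  | k + 1, P =>
      Set.InjOn (fun x => ⟪σ.p, x⟫) (vert P) ∧
        ∀ v ∈ vert P, σ.Truncates P v ∧ GenericAux k (σ.Q P v)

/-- The sweep is generic for `P`: the values `p · v` at the vertices of `P` are distinct, each
vertex of `P` is properly truncated, and the same holds for the vertex figures
of `P`, for their vertex figures, and so on. -/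
def Generic (P : Set E) : Prop :=
  σ.GenericAux (dim P) P

/-- The portion of a vertex of a `k`-polytope, by recursion on `k`. -/
def portionAux : ℕ → Set E → E → CDPoly
  | 0, _, _ => 1
  | k + 1, P, v =>
      d * cdIndex (σ.R P v) +
        ∑ᶠ w ∈ vert (σ.Q P v) ∩ σ.upper v, c * portionAux k (σ.Q P v) w

/-- The portion `Φ_v(P)` of the `cd`-index of `P` assigned to the vertex `v`. -/
def portion (P : Set E) (v : E) : CDPoly :=
  σ.portionAux (dim P) P v

end Sweep

end Sweeping

end CDSweep

end

/-! Write the `ab`-index with `a - b` in the unused positions of each chain and group chains by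
their smallest face; the empty chain counts as starting with `P`. This is `psi`. For a hyperplane `p
= t` missing the vertices, let U and L be the parts of `psi P` from faces above and below it. A face
crossing the hyperplane has a section of dimension one less with the same chains above it, so psi(P)
= U + L + (a - b) psi(section) (`psi_eq_upperSum_add`).

The induction is carried by `sweptPart`, namely U - b psi(section). Every face has a unique lowest
vertex v. The faces with lowest vertex v are {v} and those whose sections are the faces of the
vertex figure Q_v above H_v, so U is the sum of b psi(Q_v) + (a - b) U(Q_v) over the vertices v
above t (`upperSum_eq_sum_vert`). A face crosses the level iff its highest vertex lies above it and
its lowest does not, so psi(section) is the sum of L(Q_v) - U(Q_v) (`psi_inter_hyper_eq_sum_vert`).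
Splitting psi(Q_v) at H_v makes L(Q_v) cancel and leaves (ab + ba) psi(R_v) + (a + b) sweptPart(Q_v)
(`sweptPart_eq_sum_vert`): the recursion defining the portions. A level below all of `P` gives the
formula for the `cd`-index.

The same recursion, for a functional perturbed to be injective on the vertices, shows that every
`ab`-index is a polynomial in a + b and ab + ba. Uniqueness is the injectivity of the substitution
(`cdToAB_injective`). -/

open scoped RealInnerProductSpace

noncomputable section

namespace CDSweep

/-! ### Injectivity of the substitution -/

section Substitution

/-- A representation of `ℤ⟨a, b⟩` whose restriction to `ℤ⟨a + b, ab + ba⟩` is upper triangular,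
with the corresponding `cd`-polynomial in the corner. -/
def cornerRep : ABPoly →ₐ[ℤ] Matrix (Fin 2) (Fin 2) CDPoly :=
  FreeAlgebra.lift ℤ fun x : AB =>
    match x with
    | AB.a => !![0, 0; 1, c]
    | AB.b => !![c, d; -1, 0]

@[simp] lemma cornerRep_a : cornerRep a = !![0, 0; 1, c] := by
  simp [cornerRep, a]

@[simp] lemma cornerRep_b : cornerRep b = !![c, d; -1, 0] := by
  simp [cornerRep, b]

@[simp] lemma cdToAB_c : cdToAB c = a + b := by
  simp [cdToAB, c]

@[simp] lemma cdToAB_d : cdToAB d = a * b + b * a := by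
  simp [cdToAB, d]

/-- The images of `a + b` and `a * b + b * a` are `!![c, d; 0, c]` and `!![d, d * c; 0, d]`, and the
upper left entry is multiplicative on upper triangular matrices. -/
lemma cornerRep_cdToAB (φ : CDPoly) :
    cornerRep (cdToAB φ) 0 0 = φ ∧ cornerRep (cdToAB φ) 1 0 = 0 := by
  induction φ using FreeAlgebra.induction with
  | grade0 r =>
    rw [AlgHom.commutes, AlgHom.commutes, Matrix.algebraMap_matrix_apply,
      Matrix.algebraMap_matrix_apply]
    simp
  | grade1 x =>
    cases x with
    | c =>
      change cornerRep (cdToAB c) 0 0 = c ∧ cornerRep (cdToAB c) 1 0 = 0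
      simp
    | d =>
      change cornerRep (cdToAB d) 0 0 = d ∧ cornerRep (cdToAB d) 1 0 = 0
      simp
  | mul x y hx hy =>
    simp [Matrix.mul_apply, Fin.sum_univ_two, hx.1, hx.2, hy.1, hy.2]
  | add x y hx hy =>
    simp [hx.1, hx.2, hy.1, hy.2]

lemma cdToAB_injective : Function.Injective cdToAB := fun x y h => by
  rw [← (cornerRep_cdToAB x).1, h, (cornerRep_cdToAB y).1]

end Substitution

/-! ### From the flag h-vector to the flag f-vector -/

section Words

open Classical in
/-- The word in positions `k, …, k + j - 1` with `b` in the positions of `S` and `a - b`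
elsewhere. -/
def flagWord (k j : ℕ) (S : Finset ℕ) : ABPoly :=
  ((List.range' k j).map fun i => if i ∈ S then b else a - b).prod

lemma flagWord_zero (k : ℕ) (S : Finset ℕ) : flagWord k 0 S = 1 := by
  simp [flagWord]

lemma flagWord_succ (k j : ℕ) (S : Finset ℕ) :
    flagWord k (j + 1) S = (if k ∈ S then b else a - b) * flagWord (k + 1) j S := by
  simp [flagWord, List.range'_succ]

lemma flagWord_succ_last (j : ℕ) (S : Finset ℕ) :
    flagWord 0 (j + 1) S = flagWord 0 j S * (if j ∈ S then b else a - b) := by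
  simp [flagWord, List.range'_1_concat]

lemma flagWord_congr {k j : ℕ} {S T : Finset ℕ}
    (h : ∀ i, k ≤ i → i < k + j → (i ∈ S ↔ i ∈ T)) : flagWord k j S = flagWord k j T := by
  unfold flagWord
  congr 1
  refine List.map_congr_left fun i hi => ?_
  rw [List.mem_range'_1] at hi
  simp [h i hi.1 hi.2]

lemma abWord_succ (k : ℕ) (S : Finset ℕ) :
    abWord (k + 1) S = abWord k S * (if k ∈ S then b else a) := by
  simp [abWord, List.range_succ]

lemma abWord_congr {k : ℕ} {S T : Finset ℕ} (h : ∀ i < k, (i ∈ S ↔ i ∈ T)) :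
    abWord k S = abWord k T := by
  unfold abWord
  congr 1
  refine List.map_congr_left fun i hi => ?_
  rw [List.mem_range] at hi
  simp [h i hi]

/-- Expanding the factors `a - b` of the flag word chooses the positions added to `T`, each with a
sign. The induction peels off the last letter. -/
lemma sum_signed_abWord (k : ℕ) (T : Finset ℕ) (hT : T ⊆ Finset.range k) :
    ∑ S ∈ (Finset.range k).powerset,
      (if T ⊆ S then ((-1 : ℤ) ^ (S.card + T.card)) • abWord k S else 0) = flagWord 0 k T := by
  induction k generalizing T with
  | zero =>
    have : T = ∅ := by simpa using hT
    subst this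
    simp [abWord, flagWord]
  | succ k ih =>
    rw [Finset.range_add_one, Finset.sum_powerset_insert (by simp), flagWord_succ_last]
    have hins : ∀ S ∈ (Finset.range k).powerset, k ∉ S := by
      intro S hS hk
      have := Finset.mem_powerset.1 hS hk
      simp at this
    have hw : ∀ S : Finset ℕ, abWord k (insert k S) = abWord k S := fun S =>
      abWord_congr fun i hi => by simp [hi.ne]
    by_cases hk : k ∈ T
    · have hsub : T.erase k ⊆ Finset.range k := by
        intro i hi
        have h1 := hT (Finset.mem_of_mem_erase hi)
        have h2 := Finset.ne_of_mem_erase hi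
        simp at h1 ⊢
        omega
      have hfw : flagWord 0 k T = flagWord 0 k (T.erase k) :=
        flagWord_congr fun i _ hi => by
          have : i ≠ k := by omega
          simp [this]
      rw [Finset.sum_eq_zero, zero_add, if_pos hk, hfw, ← ih _ hsub, Finset.sum_mul]
      · refine Finset.sum_congr rfl fun S hS => ?_
        have hkS := hins S hS
        have hc : T.card = (T.erase k).card + 1 := (Finset.card_erase_add_one hk).symm
        have hiff : T ⊆ insert k S ↔ T.erase k ⊆ S := by
          rw [Finset.subset_insert_iff]
        simp only [hiff]
        split_ifs with h
        · rw [abWord_succ, hw, Finset.card_insert_of_notMem hkS, hc, if_pos (by simp),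
            smul_mul_assoc]
          congr 1
          ring
        · simp
      · intro S hS
        rw [if_neg]
        exact fun h => hins S hS (h hk)
    · have hsub : T ⊆ Finset.range k := by
        intro i hi
        have h1 := hT hi
        have h2 : i ≠ k := by rintro rfl; exact hk hi
        simp at h1 ⊢
        omega
      rw [if_neg hk, ← ih _ hsub, Finset.sum_mul, ← Finset.sum_add_distrib]
      refine Finset.sum_congr rfl fun S hS => ?_
      have hkS := hins S hS
      have hiff : T ⊆ insert k S ↔ T ⊆ S := by
        rw [Finset.subset_insert_iff, Finset.erase_eq_of_notMem hk]
      simp only [hiff]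
      split_ifs with h
      · rw [abWord_succ, abWord_succ, hw, Finset.card_insert_of_notMem hkS, if_neg hkS,
          if_pos (by simp), smul_mul_assoc, mul_sub, smul_sub, add_right_comm, pow_succ]
        simp [sub_eq_add_neg]
      · simp

end Words

/-! ### Generating polynomials of chains of faces -/

section Chains

variable {E : Type*} [NormedAddCommGroup E] [InnerProductSpace ℝ E]

lemma abIndex_eq_sum_flagF (P : Set E) :
    abIndex P = ∑ T ∈ (Finset.range (dim P)).powerset, (flagF P T : ℤ) • flagWord 0 (dim P) T := by
  have h1 : ∀ S ∈ (Finset.range (dim P)).powerset,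
      flagH P S • abWord (dim P) S = ∑ T ∈ (Finset.range (dim P)).powerset,
        (flagF P T : ℤ) •
          (if T ⊆ S then ((-1 : ℤ) ^ (S.card + T.card)) • abWord (dim P) S else 0) := by
    intro S hS
    rw [flagH, Finset.sum_smul]
    have hsub : S.powerset ⊆ (Finset.range (dim P)).powerset :=
      Finset.powerset_mono.2 (Finset.mem_powerset.1 hS)
    rw [← Finset.sum_subset hsub]
    · refine Finset.sum_congr rfl fun T hT => ?_
      have hT := Finset.mem_powerset.1 hT
      have hc := Finset.card_le_card hT
      rw [if_pos hT, smul_smul, mul_comm]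
      congr 2
      -- The exponents `S.card - T.card` and `S.card + T.card` have the same parity.
      obtain ⟨m, hm⟩ := Nat.exists_eq_add_of_le hc
      rw [hm, Nat.add_sub_cancel_left, show T.card + m + T.card = m + 2 * T.card by ring, pow_add]
      simp
    · intro T _ hT
      rw [if_neg (by simpa using hT), smul_zero]
  rw [abIndex, Finset.sum_congr rfl h1, Finset.sum_comm]
  refine Finset.sum_congr rfl fun T hT => ?_
  rw [← Finset.smul_sum, sum_signed_abWord _ _ (Finset.mem_powerset.1 hT)]

open Classical in
/-- The finset of nonempty faces of `P` (empty if there are infinitely many). -/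
def faces (P : Set E) : Finset (Set E) :=
  if h : {F | IsFace P F}.Finite then h.toFinset else ∅

lemma mem_faces {P : Set E} (h : {F | IsFace P F}.Finite) {F : Set E} :
    F ∈ faces P ↔ IsFace P F := by
  simp [faces, h]

/-- The `S`-chains of faces of `P` that strictly contain `X`. -/
def chainsAbove (P X : Set E) (S : Finset ℕ) : Set (S → Set E) :=
  {F | StrictMono F ∧ ∀ s : S, IsFace P (F s) ∧ dim (F s) = (s : ℕ) ∧ X ⊂ F s}

lemma chainsAbove_empty (P : Set E) (S : Finset ℕ) : chainsAbove P ∅ S = chains P S := by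
  ext F
  simp only [chainsAbove, chains, Set.mem_ofPred_eq]
  refine and_congr_right fun _ => forall_congr' fun s => ?_
  refine ⟨fun h => ⟨h.1, h.2.1⟩, fun h => ⟨h.1, h.2, ?_⟩⟩
  exact Set.empty_ssubset.2 h.1.2

lemma chainsAbove_finite {P : Set E} (h : {F | IsFace P F}.Finite) (X : Set E) (S : Finset ℕ) :
    (chainsAbove P X S).Finite :=
  (Set.Finite.pi' fun _ : S => h).subset fun _ hF s => (hF.2 s).1

open Classical in
/-- Chains whose smallest member has dimension `k` are pairs of that member and a chain above. -/
def chainsAboveInsertEquiv {P : Set E} (h : {F | IsFace P F}.Finite) (X : Set E) (k : ℕ)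
    (S : Finset ℕ) (hk : ∀ s ∈ S, k < s) :
    chainsAbove P X (insert k S) ≃
      Σ F : {F // F ∈ (faces P).filter fun F => X ⊂ F ∧ dim F = k}, chainsAbove P F.1 S where
  toFun c := ⟨⟨c.1 ⟨k, Finset.mem_insert_self _ _⟩, by
      have := c.2.2 ⟨k, Finset.mem_insert_self _ _⟩
      rw [Finset.mem_filter, mem_faces h]
      exact ⟨this.1, this.2.2, this.2.1⟩⟩,
    ⟨fun s => c.1 ⟨s, Finset.mem_insert_of_mem s.2⟩, fun s t hst => c.2.1 (by simpa using hst),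
      fun s => ⟨(c.2.2 _).1, (c.2.2 _).2.1, c.2.1 (by simpa using hk s.1 s.2)⟩⟩⟩
  invFun x := ⟨fun s => if hs : s.1 = k then x.1.1 else
      x.2.1 ⟨s.1, Finset.mem_of_mem_insert_of_ne s.2 hs⟩, by
    obtain ⟨⟨F, hF⟩, ⟨g, hg⟩⟩ := x
    rw [Finset.mem_filter, mem_faces h] at hF
    refine ⟨fun s t hst => ?_, fun s => ?_⟩
    · by_cases hs : s.1 = k <;> by_cases ht : t.1 = k
      · exact absurd hst (by rw [← Subtype.coe_lt_coe, hs, ht]; exact lt_irrefl k)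
      · simp only [hs, ht, dite_true, dite_false]
        exact (hg.2 _).2.2
      · have h1 := hk s.1 (Finset.mem_of_mem_insert_of_ne s.2 hs)
        have h2 : s.1 < t.1 := hst
        omega
      · simp only [hs, ht, dite_false]
        exact hg.1 hst
    · by_cases hs : s.1 = k
      · simp only [hs, dite_true]
        exact ⟨hF.1, hF.2.2, hF.2.1⟩
      · simp only [hs, dite_false]
        exact ⟨(hg.2 _).1, (hg.2 _).2.1, hF.2.1.trans (hg.2 _).2.2⟩⟩
  left_inv c := by
    ext1
    funext s
    by_cases hs : s.1 = k
    · simp only [hs, dite_true]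
      exact congrArg c.1 (Subtype.ext hs.symm)
    · simp [hs]
  right_inv x := by
    obtain ⟨⟨F, hF⟩, ⟨g, hg⟩⟩ := x
    refine Sigma.ext (Subtype.ext (by simp)) ?_
    refine (Subtype.heq_iff_coe_eq ?_).2 ?_
    · intro x
      simp
    · funext s
      have : s.1 ≠ k := (hk s.1 s.2).ne'
      simp [this]

open Classical in
lemma ncard_chainsAbove_insert {P : Set E} (h : {F | IsFace P F}.Finite) (X : Set E) (k : ℕ)
    (S : Finset ℕ) (hk : ∀ s ∈ S, k < s) :
    (chainsAbove P X (insert k S)).ncard =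
      ∑ F ∈ faces P with X ⊂ F ∧ dim F = k, (chainsAbove P F S).ncard := by
  have hfin : ∀ F : Set E, Finite (chainsAbove P F S) := fun F =>
    (chainsAbove_finite h F S).to_subtype
  rw [← Nat.card_coe_set_eq, Nat.card_congr (chainsAboveInsertEquiv h X k S hk), Nat.card_sigma]
  simp only [Nat.card_coe_set_eq]
  exact Finset.sum_coe_sort _ fun F => (chainsAbove P F S).ncard

open Classical in
/-- The generating polynomial of the chains of faces of `P` that strictly contain `X`, recorded
in the last `j` positions. -/
def chainSum (P : Set E) : ℕ → Set E → ABPoly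
  | 0, _ => 1
  | j + 1, X => (a - b) * chainSum P j X +
      b * ∑ F ∈ faces P with X ⊂ F ∧ dim F + (j + 1) = dim P, chainSum P j F

/-- One step of the recursion treats position `k`: a chain either skips this dimension or has its
smallest member there. -/
lemma chainSum_eq {P : Set E} (h : {F | IsFace P F}.Finite) (j k : ℕ) (hkj : k + j = dim P)
    (X : Set E) :
    chainSum P j X = ∑ S ∈ (Finset.Ico k (k + j)).powerset,
      ((chainsAbove P X S).ncard : ℤ) • flagWord k j S := by
  classical
  induction j generalizing k X with
  | zero =>
    have : chainsAbove P X ∅ = Set.univ := by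
      ext F
      simp only [chainsAbove, Set.mem_ofPred_eq, Set.mem_univ, iff_true]
      exact ⟨fun s => absurd s.2 (Finset.notMem_empty _), fun s => absurd s.2 (Finset.notMem_empty _)⟩
    simp [chainSum, flagWord_zero, this]
  | succ j ih =>
    have hI : Finset.Ico k (k + (j + 1)) = insert k (Finset.Ico (k + 1) (k + 1 + j)) := by
      rw [show k + (j + 1) = k + 1 + j by ring]
      rw [Finset.insert_Ico_add_one_left_eq_Ico (by omega)]
    have hmem : ∀ S ∈ (Finset.Ico (k + 1) (k + 1 + j)).powerset, ∀ s ∈ S, k < s := by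
      intro S hS s hs
      have := Finset.mem_Ico.1 (Finset.mem_powerset.1 hS hs)
      omega
    rw [hI, Finset.sum_powerset_insert (by simp), chainSum, ih (k + 1) (by omega) X,
      Finset.mul_sum]
    congr 1
    · refine Finset.sum_congr rfl fun S hS => ?_
      have : k ∉ S := fun hk => lt_irrefl _ (hmem S hS k hk)
      rw [flagWord_succ, if_neg this, mul_smul_comm]
    · have hF : ∀ F ∈ (faces P).filter (fun F => X ⊂ F ∧ dim F + (j + 1) = dim P),
          chainSum P j F = ∑ S ∈ (Finset.Ico (k + 1) (k + 1 + j)).powerset,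
            ((chainsAbove P F S).ncard : ℤ) • flagWord (k + 1) j S :=
        fun F _ => ih (k + 1) (by omega) F
      rw [Finset.sum_congr rfl hF, Finset.sum_comm, Finset.mul_sum]
      refine Finset.sum_congr rfl fun S hS => ?_
      rw [ncard_chainsAbove_insert h X k S (hmem S hS), flagWord_succ, if_pos (by simp),
        flagWord_congr (S := insert k S) (T := S) (fun i hi _ => by
          have : i ≠ k := by omega
          simp [this]), ← Finset.sum_smul, mul_smul_comm]
      push_cast
      congr 1
      refine Finset.sum_congr ?_ fun _ _ => rfl
      refine Finset.filter_congr fun F _ => ?_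
      rw [show dim F + (j + 1) = dim P ↔ dim F = k by omega]

lemma abIndex_eq_chainSum {P : Set E} (h : {F | IsFace P F}.Finite) :
    abIndex P = chainSum P (dim P) ∅ := by
  rw [abIndex_eq_sum_flagF, chainSum_eq h (dim P) 0 (by simp)]
  simp only [zero_add, Nat.Ico_zero_eq_range, chainsAbove_empty, flagF]

open Classical in
/-- The generating polynomial of the chains of proper faces of `P` that start with `F`, recorded
in the positions from `dim F` on; the chain starting with `P` itself is empty. -/
def tail (P F : Set E) : ABPoly :=
  if F = P then 1 else b * chainSum P (dim P - dim F - 1) F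

open Classical in
-- Chains are grouped by their smallest member, the recorded positions before it giving a power of
-- `a - b`. The term `F = P` stands for the empty chain.
lemma chainSum_eq_sum_tail {P : Set E} (h : {F | IsFace P F}.Finite) (hPP : IsFace P P)
    (hdim : ∀ F, IsFace P F → F ≠ P → dim F < dim P) (j : ℕ) (hj : j ≤ dim P)
    (X : Set E) (hX : X ⊂ P) :
    chainSum P j X = ∑ F ∈ faces P with X ⊂ F ∧ dim P ≤ dim F + j,
      (a - b) ^ (dim F + j - dim P) * tail P F := by
  induction j generalizing X with
  | zero =>
    have : (faces P).filter (fun F => X ⊂ F ∧ dim P ≤ dim F + 0) = {P} := by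
      ext F
      simp only [Finset.mem_filter, mem_faces h, Finset.mem_singleton]
      constructor
      · rintro ⟨h1, -, h3⟩
        by_contra hne
        have := hdim F h1 hne
        omega
      · rintro rfl
        exact ⟨hPP, hX, by simp⟩
    rw [this]
    simp [chainSum, tail]
  | succ j ih =>
    have hsplit : (faces P).filter (fun F => X ⊂ F ∧ dim P ≤ dim F + (j + 1)) =
        (faces P).filter (fun F => X ⊂ F ∧ dim P ≤ dim F + j) ∪
        (faces P).filter (fun F => X ⊂ F ∧ dim F + (j + 1) = dim P) := by
      ext F
      simp only [Finset.mem_filter, Finset.mem_union, ← and_or_left]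
      refine and_congr_right fun _ => and_congr_right fun _ => ?_
      omega
    have hdisj : Disjoint ((faces P).filter (fun F => X ⊂ F ∧ dim P ≤ dim F + j))
        ((faces P).filter (fun F => X ⊂ F ∧ dim F + (j + 1) = dim P)) := by
      rw [Finset.disjoint_filter]
      rintro F - ⟨-, h1⟩ ⟨-, h2⟩
      omega
    rw [hsplit, Finset.sum_union hdisj, chainSum, ih (by omega) X hX, Finset.mul_sum,
      Finset.mul_sum]
    congr 1
    · refine Finset.sum_congr rfl fun F hF => ?_
      have := (Finset.mem_filter.1 hF).2.2
      rw [show dim F + (j + 1) - dim P = (dim F + j - dim P) + 1 by omega, pow_succ', mul_assoc]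
    · refine Finset.sum_congr rfl fun F hF => ?_
      have := (Finset.mem_filter.1 hF).2.2
      have hne : F ≠ P := by rintro rfl; omega
      rw [show dim F + (j + 1) - dim P = 0 by omega, pow_zero, one_mul, tail, if_neg hne,
        show dim P - dim F - 1 = j by omega]

/-- The generating polynomial of the chains of proper faces of `P` that start with `F`. -/
def startSum (P F : Set E) : ABPoly := (a - b) ^ dim F * tail P F

/-- The `ab`-index of a polytope, as a sum over the smallest members of chains; it vanishes for the
empty set. -/
def psi (P : Set E) : ABPoly := ∑ F ∈ faces P, startSum P F

lemma abIndex_eq_psi {P : Set E} (h : {F | IsFace P F}.Finite) (hPP : IsFace P P)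
    (hdim : ∀ F, IsFace P F → F ≠ P → dim F < dim P) : abIndex P = psi P := by
  classical
  rw [abIndex_eq_chainSum h,
    chainSum_eq_sum_tail h hPP hdim _ le_rfl _ (Set.empty_ssubset.2 hPP.2), psi]
  simp only [startSum, Nat.add_sub_cancel]
  refine Finset.sum_congr ?_ fun _ _ => rfl
  refine Finset.filter_true_of_mem fun F hF => ⟨?_, by omega⟩
  exact Set.empty_ssubset.2 ((mem_faces h).1 hF).2

end Chains

/-! ### Faces and hyperplane sections of polytopes -/

section Geometry

variable {E : Type*} [NormedAddCommGroup E] [InnerProductSpace ℝ E]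

/-- A possibly empty polytope. -/
def IsPoly (P : Set E) : Prop := ∃ s : Finset E, P = convexHull ℝ (s : Set E)

lemma IsPolytope.isPoly {P : Set E} (h : IsPolytope P) : IsPoly P := h.2

lemma isPoly_of_finite {s : Set E} (hs : s.Finite) : IsPoly (convexHull ℝ s) :=
  ⟨hs.toFinset, by simp⟩

namespace IsPoly

variable {P : Set E} (hP : IsPoly P)

include hP

lemma isCompact : IsCompact P := by
  obtain ⟨s, rfl⟩ := hP
  exact s.finite_toSet.isCompact_convexHull ℝ

lemma convex : Convex ℝ P := by
  obtain ⟨s, rfl⟩ := hP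
  exact convex_convexHull ℝ _

lemma vert_finite : (vert P).Finite := by
  obtain ⟨s, rfl⟩ := hP
  exact s.finite_toSet.subset extremePoints_convexHull_subset

lemma convexHull_vert : convexHull ℝ (vert P) = P := by
  rw [← (hP.vert_finite.isClosed_convexHull ℝ).closure_eq]
  exact closure_convexHull_extremePoints hP.isCompact hP.convex

lemma subset_of_vert_subset {C : Set E} (hC : Convex ℝ C) (h : vert P ⊆ C) : P ⊆ C := by
  rw [← hP.convexHull_vert]
  exact convexHull_min h hC

lemma vert_nonempty (h : P.Nonempty) : (vert P).Nonempty :=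
  hP.isCompact.extremePoints_nonempty h

end IsPoly

lemma vert_subset (P : Set E) : vert P ⊆ P := extremePoints_subset

lemma isFace_iff {P F : Set E} : IsFace P F ↔ F.Nonempty ∧ ∃ (l : StrongDual ℝ E) (m : ℝ),
    (∀ x ∈ P, l x ≤ m) ∧ F = {x ∈ P | l x = m} := by
  constructor
  · rintro ⟨h, hne⟩
    refine ⟨hne, ?_⟩
    obtain ⟨l, hl⟩ := h hne
    obtain ⟨y, hy⟩ := hne
    have hy' := hy
    rw [hl] at hy'
    refine ⟨l, l y, hy'.2, ?_⟩
    rw [hl]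
    ext x
    constructor
    · rintro ⟨h1, h2⟩
      exact ⟨h1, le_antisymm (hy'.2 x h1) (h2 y hy'.1)⟩
    · rintro ⟨h1, h2⟩
      exact ⟨h1, fun z hz => h2 ▸ hy'.2 z hz⟩
  · rintro ⟨hne, l, m, hle, rfl⟩
    refine ⟨fun _ => ⟨l, ?_⟩, hne⟩
    obtain ⟨y, hyP, hy⟩ := hne
    ext x
    constructor
    · rintro ⟨h1, h2⟩
      exact ⟨h1, fun z hz => h2 ▸ hle z hz⟩
    · rintro ⟨h1, h2⟩
      exact ⟨h1, le_antisymm (hle x h1) (hy ▸ h2 y hyP)⟩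

lemma isFace_self {P : Set E} (h : P.Nonempty) : IsFace P P := ⟨IsExposed.refl P, h⟩

lemma IsFace.subset {P F : Set E} (h : IsFace P F) : F ⊆ P := h.1.subset

lemma IsFace.vert_eq {P F : Set E} (h : IsFace P F) : vert F = F ∩ vert P :=
  h.1.isExtreme.extremePoints_eq

lemma IsFace.isPoly {P F : Set E} (h : IsFace P F) (hP : IsPoly P) : IsPoly F := by
  have hfin : (vert F).Finite := hP.vert_finite.subset (h.vert_eq ▸ Set.inter_subset_right)
  have : F = convexHull ℝ (vert F) := by
    rw [← (hfin.isClosed_convexHull ℝ).closure_eq]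
    exact (closure_convexHull_extremePoints (h.1.isCompact hP.isCompact)
      (h.1.convex hP.convex)).symm
  rw [this]
  exact isPoly_of_finite hfin

/-- A face is the convex hull of its vertices, which are vertices of `P`. -/
lemma IsPoly.faces_finite {P : Set E} (hP : IsPoly P) : {F | IsFace P F}.Finite := by
  refine Set.Finite.of_injOn (f := vert) (t := 𝒫 (vert P)) ?_ ?_ hP.vert_finite.finite_subsets
  · intro F hF
    exact (IsFace.vert_eq hF) ▸ Set.inter_subset_right
  · intro F hF G hG h
    rw [← (IsFace.isPoly hF hP).convexHull_vert, h, (IsFace.isPoly hG hP).convexHull_vert]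

lemma IsPoly.mem_faces {P : Set E} (hP : IsPoly P) {F : Set E} : F ∈ faces P ↔ IsFace P F :=
  CDSweep.mem_faces hP.faces_finite

lemma IsPoly.exists_truncation {P : Set E} (hP : IsPoly P) {v : E} (hv : v ∈ vert P) :
    ∃ (l : StrongDual ℝ E) (m : ℝ), l v < m ∧ ∀ u ∈ vert P, u ≠ v → m < l u := by
  have h1 := (hP.convex.mem_extremePoints_iff_mem_sdiff_convexHull_sdiff.1 hv).2
  have h2 : v ∉ convexHull ℝ (vert P \ {v}) := fun h =>
    h1 (convexHull_mono (Set.sdiff_subset_sdiff_left (vert_subset P)) h)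
  obtain ⟨f, u, hf, hu⟩ := geometric_hahn_banach_point_closed (convex_convexHull ℝ _)
    ((hP.vert_finite.subset Set.sdiff_subset).isClosed_convexHull ℝ) h2
  exact ⟨f, u, hf, fun w hw hne => hu w (subset_convexHull ℝ _ ⟨hw, hne⟩)⟩

lemma IsPoly.isFace_singleton {P : Set E} (hP : IsPoly P) {v : E} (hv : v ∈ vert P) :
    IsFace P {v} := by
  obtain ⟨l, m, hl, hm⟩ := hP.exists_truncation hv
  have hle : P ⊆ {x | l v ≤ l x} :=
    hP.subset_of_vert_subset (convex_halfSpace_ge l.toLinearMap.isLinear _) fun u hu => by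
      by_cases huv : u = v
      · simp [huv]
      · exact (hl.trans (hm u hu huv)).le
  have hF : IsFace P {x ∈ P | (-l) x = -l v} :=
    isFace_iff.2 ⟨⟨v, vert_subset P hv, rfl⟩, -l, -l v, fun x hx => neg_le_neg (hle hx), rfl⟩
  have hvert : vert {x ∈ P | (-l) x = -l v} = {v} := by
    rw [hF.vert_eq]
    ext u
    constructor
    · rintro ⟨⟨-, h2⟩, hu⟩
      by_contra hne
      have h3 : l u = l v := by simpa using h2
      exact absurd (hl.trans (hm u hu hne)) (by simp [h3])
    · rintro rfl
      exact ⟨⟨vert_subset P hv, rfl⟩, hv⟩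
  rw [← (hF.isPoly hP).convexHull_vert, hvert, convexHull_singleton] at hF
  exact hF

lemma dim_singleton (v : E) : dim ({v} : Set E) = 0 := by
  simp [dim, direction_affineSpan]

lemma exists_eq_singleton_of_dim_eq_zero [FiniteDimensional ℝ E] {P : Set E} (hne : P.Nonempty)
    (h : dim P = 0) : ∃ v, P = {v} := by
  obtain ⟨v, hv⟩ := hne
  refine ⟨v, Set.Subset.antisymm (fun x hx => ?_) (by simpa using hv)⟩
  have h1 : (affineSpan ℝ P).direction = ⊥ := Submodule.finrank_eq_zero.1 h
  have h2 : x -ᵥ v ∈ (affineSpan ℝ P).direction :=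
    AffineSubspace.vsub_mem_direction (subset_affineSpan ℝ P hx) (subset_affineSpan ℝ P hv)
  rw [h1, Submodule.mem_bot, vsub_eq_sub, sub_eq_zero] at h2
  exact h2

lemma vert_singleton (v : E) : vert ({v} : Set E) = {v} := extremePoints_singleton

/-- The functional exposing `F` vanishes on the directions of `F` but not on all those of `P`. -/
lemma IsFace.dim_lt [FiniteDimensional ℝ E] {P F : Set E} (h : IsFace P F) (hne : F ≠ P) :
    dim F < dim P := by
  obtain ⟨⟨y, hy⟩, l, m, hle, hF⟩ := isFace_iff.1 h
  have hz : ∃ z ∈ P, l z ≠ m := by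
    by_contra! hcon
    exact hne (hF.trans (Set.sep_eq_self_iff_mem_true.2 hcon))
  obtain ⟨z, hz, hlz⟩ := hz
  have hlF : ∀ x ∈ F, l x = m := fun x hx => by rw [hF] at hx; exact hx.2
  refine Submodule.finrank_lt_finrank_of_lt (lt_of_le_of_ne
    (AffineSubspace.direction_le (affineSpan_mono ℝ h.subset)) fun heq => ?_)
  have hker : (affineSpan ℝ F).direction ≤ LinearMap.ker l.toLinearMap := by
    rw [direction_affineSpan, vectorSpan_def, Submodule.span_le]
    rintro _ ⟨x, hx, x', hx', rfl⟩
    simp [hlF x hx, hlF x' hx']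
  have : z -ᵥ y ∈ (affineSpan ℝ P).direction :=
    AffineSubspace.vsub_mem_direction (subset_affineSpan ℝ P hz)
      (subset_affineSpan ℝ P (h.subset hy))
  rw [← heq] at this
  have h0 := hker this
  simp only [vsub_eq_sub, LinearMap.mem_ker, map_sub, sub_eq_zero] at h0
  exact hlz (h0.trans (hlF y hy))

/-- The hyperplane where the functional `l` takes the value `t`. -/
def hyper (l : StrongDual ℝ E) (t : ℝ) : Set E := {x | l x = t}

/-- The point where the segment from `u` to `w` crosses the hyperplane `l = t`. -/
def cross (l : StrongDual ℝ E) (t : ℝ) (u w : E) : E :=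
  u + ((t - l u) / (l w - l u)) • (w - u)

lemma apply_cross {l g : StrongDual ℝ E} {t : ℝ} (u w : E) :
    g (cross l t u w) = g u + ((t - l u) / (l w - l u)) * (g w - g u) := by
  simp [cross]

lemma cross_coeff_pos {l : StrongDual ℝ E} {t : ℝ} {u w : E} (hu : l u < t) (hw : t < l w) :
    0 < (t - l u) / (l w - l u) := div_pos (by linarith) (by linarith)

lemma cross_coeff_lt_one {l : StrongDual ℝ E} {t : ℝ} {u w : E} (hu : l u < t) (hw : t < l w) :
    (t - l u) / (l w - l u) < 1 := (div_lt_one (by linarith)).2 (by linarith)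

lemma cross_mem_hyper {l : StrongDual ℝ E} {t : ℝ} {u w : E} (hu : l u < t) (hw : t < l w) :
    cross l t u w ∈ hyper l t := by
  have : l w - l u ≠ 0 := by linarith
  change l (cross l t u w) = t
  rw [apply_cross]
  field_simp
  ring

lemma cross_mem_openSegment {l : StrongDual ℝ E} {t : ℝ} {u w : E} (hu : l u < t)
    (hw : t < l w) : cross l t u w ∈ openSegment ℝ u w := by
  rw [openSegment_eq_image']
  exact ⟨_, ⟨cross_coeff_pos hu hw, cross_coeff_lt_one hu hw⟩, rfl⟩

lemma cross_mem {l : StrongDual ℝ E} {t : ℝ} {u w : E} {C : Set E} (hC : Convex ℝ C)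
    (hu : l u < t) (hw : t < l w) (huC : u ∈ C) (hwC : w ∈ C) : cross l t u w ∈ C :=
  hC.openSegment_subset huC hwC (cross_mem_openSegment hu hw)

/-- Lagrange multipliers: a bound for `g` at the crossing points extends to all points after
adding a multiple of `l - t`. -/
lemma exists_multiplier {V : Set E} (hV : V.Finite) {l g : StrongDual ℝ E} {t m : ℝ}
    (hVt : ∀ v ∈ V, l v ≠ t)
    (h : ∀ u ∈ V, ∀ w ∈ V, l u < t → t < l w → g (cross l t u w) ≤ m) :
    ∃ r : ℝ, ∀ v ∈ V, g v + r * (l v - t) ≤ m := by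
  -- Points below the level bound `r` from below, points above it bound `r` from above. The
  -- hypothesis at the crossing point of `u` and `w` says that their two bounds are compatible.
  set lo : Set ℝ := (fun u => (g u - m) / (t - l u)) '' {u ∈ V | l u < t} with hlo
  set hi : Set ℝ := (fun w => (m - g w) / (l w - t)) '' {w ∈ V | t < l w} with hhi
  have hlof : lo.Finite := (hV.subset (Set.sep_subset _ _)).image _
  have hhif : hi.Finite := (hV.subset (Set.sep_subset _ _)).image _
  have hle : ∀ x ∈ lo, ∀ y ∈ hi, x ≤ y := by
    rintro _ ⟨u, ⟨huV, hu⟩, rfl⟩ _ ⟨w, ⟨hwV, hw⟩, rfl⟩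
    have h1 := h u huV w hwV hu hw
    rw [apply_cross, div_mul_eq_mul_div, ← le_sub_iff_add_le', div_le_iff₀ (by linarith)] at h1
    change (g u - m) / (t - l u) ≤ (m - g w) / (l w - t)
    rw [div_le_div_iff₀ (by linarith) (by linarith)]
    linarith
  have hr : ∃ r : ℝ, (∀ x ∈ lo, x ≤ r) ∧ ∀ y ∈ hi, r ≤ y := by
    rcases lo.eq_empty_or_nonempty with h0 | h0
    · exact ⟨sInf hi, by simp [h0], fun y hy => csInf_le hhif.bddBelow hy⟩
    · exact ⟨sSup lo, fun x hx => le_csSup hlof.bddAbove hx,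
        fun y hy => csSup_le h0 fun x hx => hle x hx y hy⟩
  obtain ⟨r, hr1, hr2⟩ := hr
  refine ⟨r, fun v hv => ?_⟩
  rcases lt_or_gt_of_ne (hVt v hv) with hlt | hgt
  · have := hr1 _ ⟨v, ⟨hv, hlt⟩, rfl⟩
    simp only at this
    rw [div_le_iff₀ (by linarith)] at this
    linarith
  · have := hr2 _ ⟨v, ⟨hv, hgt⟩, rfl⟩
    simp only at this
    rw [le_div_iff₀ (by linarith)] at this
    linarith

/-- The crossing points of the segments between points of `V`. -/
def crossSet (l : StrongDual ℝ E) (t : ℝ) (V : Set E) : Set E :=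
  {x | ∃ u ∈ V, ∃ w ∈ V, l u < t ∧ t < l w ∧ x = cross l t u w}

lemma crossSet_finite {l : StrongDual ℝ E} {t : ℝ} {V : Set E} (hV : V.Finite) :
    (crossSet l t V).Finite := by
  refine (hV.image2 (cross l t) hV).subset ?_
  rintro x ⟨u, hu, w, hw, -, -, rfl⟩
  exact ⟨u, hu, w, hw, rfl⟩

section Cut

variable {P : Set E} (hP : IsPoly P) {l : StrongDual ℝ E} {t : ℝ} (ht : ∀ v ∈ vert P, l v ≠ t)

include hP ht

/-- If `g` separated a point of the section from the crossing points, a multiplier would extend the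
bound for `g` to all of `P`. The added term vanishes on the hyperplane, so the bound would hold at
that point too. -/
lemma inter_hyper_eq_convexHull : P ∩ hyper l t = convexHull ℝ (crossSet l t (vert P)) := by
  refine Set.Subset.antisymm ?_ (convexHull_min ?_ ?_)
  · rintro y ⟨hyP, hy⟩
    by_contra hcon
    obtain ⟨g, m, hg, hm⟩ := geometric_hahn_banach_closed_point (convex_convexHull ℝ _)
      ((crossSet_finite hP.vert_finite).isClosed_convexHull ℝ) hcon
    obtain ⟨r, hr⟩ := exists_multiplier (m := m) (g := g) hP.vert_finite ht
      fun u hu w hw h1 h2 => (hg _ (subset_convexHull ℝ _ ⟨u, hu, w, hw, h1, h2, rfl⟩)).le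
    have hsub : P ⊆ {x | (g + r • l) x ≤ m + r * t} :=
      hP.subset_of_vert_subset (convex_halfSpace_le (g + r • l).toLinearMap.isLinear _)
        fun v hv => by
          have := hr v hv
          simp only [Set.mem_ofPred_eq, _root_.add_apply,
            _root_.smul_apply, smul_eq_mul]
          linarith
    have h1 := hsub hyP
    have h2 : l y = t := hy
    simp only [Set.mem_ofPred_eq, _root_.add_apply,
      _root_.smul_apply, smul_eq_mul, h2] at h1
    linarith
  · rintro x ⟨u, hu, w, hw, h1, h2, rfl⟩
    exact ⟨cross_mem hP.convex h1 h2 (vert_subset P hu) (vert_subset P hw),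
      cross_mem_hyper h1 h2⟩
  · exact hP.convex.inter (convex_hyperplane l.toLinearMap.isLinear t)

lemma isPoly_inter_hyper : IsPoly (P ∩ hyper l t) := by
  rw [inter_hyper_eq_convexHull hP ht]
  exact isPoly_of_finite (crossSet_finite hP.vert_finite)

lemma vert_inter_hyper_subset : vert (P ∩ hyper l t) ⊆ crossSet l t (vert P) := by
  rw [inter_hyper_eq_convexHull hP ht]
  exact extremePoints_convexHull_subset

lemma inter_hyper_nonempty_iff :
    (P ∩ hyper l t).Nonempty ↔ (∃ u ∈ vert P, l u < t) ∧ ∃ w ∈ vert P, t < l w := by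
  rw [inter_hyper_eq_convexHull hP ht, convexHull_nonempty_iff]
  constructor
  · rintro ⟨x, u, hu, w, hw, h1, h2, -⟩
    exact ⟨⟨u, hu, h1⟩, ⟨w, hw, h2⟩⟩
  · rintro ⟨⟨u, hu, h1⟩, ⟨w, hw, h2⟩⟩
    exact ⟨_, u, hu, w, hw, h1, h2, rfl⟩

/-- A functional supporting the section along `G` becomes one supporting `P` after adding a multiple
of `l`, which is constant on the hyperplane. -/
lemma exists_face_of_face_inter_hyper {G : Set E} (hG : IsFace (P ∩ hyper l t) G) :
    ∃ F, IsFace P F ∧ F ∩ hyper l t = G := by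
  obtain ⟨⟨y, hy⟩, g, m, hle, hGe⟩ := isFace_iff.1 hG
  obtain ⟨r, hr⟩ := exists_multiplier (m := m) (g := g) hP.vert_finite ht
    fun u hu w hw h1 h2 => hle _ ⟨cross_mem hP.convex h1 h2 (vert_subset P hu)
      (vert_subset P hw), cross_mem_hyper h1 h2⟩
  have hsub : P ⊆ {x | (g + r • l) x ≤ m + r * t} :=
    hP.subset_of_vert_subset (convex_halfSpace_le (g + r • l).toLinearMap.isLinear _)
      fun v hv => by
        have := hr v hv
        simp only [Set.mem_ofPred_eq, _root_.add_apply,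
          _root_.smul_apply, smul_eq_mul]
        linarith
  have heq : {x ∈ P | (g + r • l) x = m + r * t} ∩ hyper l t = G := by
    rw [hGe]
    ext x
    constructor
    · rintro ⟨⟨h1, h2⟩, h3 : l x = t⟩
      simp only [_root_.add_apply,
        _root_.smul_apply, smul_eq_mul, h3] at h2
      exact ⟨⟨h1, h3⟩, by linarith⟩
    · rintro ⟨⟨h1, h3 : l x = t⟩, h2⟩
      refine ⟨⟨h1, ?_⟩, h3⟩
      simp [h2, h3]
  refine ⟨_, isFace_iff.2 ⟨?_, g + r • l, m + r * t, hsub, rfl⟩, heq⟩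
  rw [← heq] at hy
  exact ⟨y, hy.1⟩

omit hP ht in
lemma IsFace.inter_hyper {F : Set E} (hF : IsFace P F) (hne : (F ∩ hyper l t).Nonempty) :
    IsFace (P ∩ hyper l t) (F ∩ hyper l t) := by
  obtain ⟨-, g, m, hle, hFe⟩ := isFace_iff.1 hF
  refine isFace_iff.2 ⟨hne, g, m, fun x hx => hle x hx.1, ?_⟩
  rw [hFe]
  ext x
  simp only [Set.mem_inter_iff, Set.mem_ofPred_eq]
  tauto

omit hP in
lemma IsFace.vert_ne {F : Set E} (hF : IsFace P F) : ∀ v ∈ vert F, l v ≠ t :=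
  fun v hv => ht v (hF.vert_eq ▸ hv).2

/-- Each vertex of `F` is an end of a segment between vertices of `F` that crosses the hyperplane.
The crossing point lies in `G`, and `G` is extreme, so both ends lie in `G`. -/
lemma IsFace.subset_of_inter_hyper_subset {F G : Set E} (hF : IsFace P F) (hG : IsFace P G)
    (hne : (F ∩ hyper l t).Nonempty) (h : F ∩ hyper l t ⊆ G ∩ hyper l t) : F ⊆ G := by
  have hFp := hF.isPoly hP
  have hFt := IsFace.vert_ne (l := l) ht hF
  obtain ⟨⟨u₀, hu₀, hu₀t⟩, ⟨w₀, hw₀, hw₀t⟩⟩ := (inter_hyper_nonempty_iff hFp hFt).1 hne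
  have key : ∀ u ∈ vert F, ∀ w ∈ vert F, l u < t → t < l w → u ∈ G ∧ w ∈ G := by
    intro u hu w hw h1 h2
    have hu' := vert_subset F hu
    have hw' := vert_subset F hw
    have hx := (h ⟨cross_mem hFp.convex h1 h2 hu' hw', cross_mem_hyper h1 h2⟩).1
    have hs := cross_mem_openSegment h1 h2
    exact ⟨hG.1.isExtreme.2 (hF.subset hu') (hF.subset hw') hx hs,
      hG.1.isExtreme.right_mem_of_mem_openSegment (hF.subset hu') (hF.subset hw') hx hs⟩
  refine hFp.subset_of_vert_subset (hG.isPoly hP).convex fun v hv => ?_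
  rcases lt_or_gt_of_ne (hFt v hv) with hlt | hgt
  · exact (key v hv w₀ hw₀ hlt hw₀t).1
  · exact (key u₀ hu₀ v hv hu₀t hgt).2

lemma IsFace.inter_hyper_inj {F G : Set E} (hF : IsFace P F) (hG : IsFace P G)
    (hne : (F ∩ hyper l t).Nonempty) (h : F ∩ hyper l t = G ∩ hyper l t) : F = G :=
  Set.Subset.antisymm (hF.subset_of_inter_hyper_subset hP ht hG hne h.subset)
    (hG.subset_of_inter_hyper_subset hP ht hF (h ▸ hne) h.symm.subset)

/-- The directions of the section and one vector `w - u` joining vertices on opposite sides span the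
directions of `P`; `l` vanishes on the former but not on `w - u`. -/
lemma dim_inter_hyper [FiniteDimensional ℝ E] (hne : (P ∩ hyper l t).Nonempty) :
    dim P = dim (P ∩ hyper l t) + 1 := by
  obtain ⟨⟨u, hu, hut⟩, ⟨w, hw, hwt⟩⟩ := (inter_hyper_nonempty_iff hP ht).1 hne
  set D := (affineSpan ℝ (P ∩ hyper l t)).direction with hD
  set A := (affineSpan ℝ P).direction with hA
  have hDA : D ≤ A := AffineSubspace.direction_le (affineSpan_mono ℝ Set.inter_subset_left)
  have hsub : ∀ x ∈ P ∩ hyper l t, ∀ y ∈ P ∩ hyper l t, x - y ∈ D := fun x hx y hy =>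
    AffineSubspace.vsub_mem_direction (subset_affineSpan ℝ _ hx) (subset_affineSpan ℝ _ hy)
  have hcr : ∀ u ∈ vert P, ∀ w ∈ vert P, l u < t → t < l w →
      cross l t u w ∈ P ∩ hyper l t := fun u hu w hw h1 h2 =>
    ⟨cross_mem hP.convex h1 h2 (vert_subset P hu) (vert_subset P hw), cross_mem_hyper h1 h2⟩
  have hDker : ∀ x ∈ D, l x = 0 := by
    have : D ≤ LinearMap.ker l.toLinearMap := by
      rw [hD, direction_affineSpan, vectorSpan_def, Submodule.span_le]
      rintro _ ⟨x, hx, y, hy, rfl⟩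
      have h1 : l x = t := hx.2
      have h2 : l y = t := hy.2
      simp [h1, h2]
    exact fun x hx => this hx
  have hlt : D < A := by
    refine lt_of_le_of_ne hDA fun heq => ?_
    have : w - u ∈ A := AffineSubspace.vsub_mem_direction
      (subset_affineSpan ℝ _ (vert_subset P hw)) (subset_affineSpan ℝ _ (vert_subset P hu))
    have := hDker _ (heq ▸ this)
    rw [map_sub] at this
    linarith
  set W := D ⊔ Submodule.span ℝ {w - u} with hW
  have hwu : w - u ∈ W := Submodule.mem_sup_right (Submodule.mem_span_singleton_self _)
  have hhigh : ∀ w' ∈ vert P, t < l w' → w' - u ∈ W := by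
    intro w' hw' hw't
    -- Two segments with the common end `u` cross at points differing by a direction of the section;
    -- solve for the direction of the second segment.
    have h1 : cross l t u w' - cross l t u w ∈ W :=
      Submodule.mem_sup_left (hsub _ (hcr u hu w' hw' hut hw't) _ (hcr u hu w hw hut hwt))
    have h2 : ((t - l u) / (l w' - l u)) • (w' - u) ∈ W := by
      have : ((t - l u) / (l w' - l u)) • (w' - u) =
          (cross l t u w' - cross l t u w) + ((t - l u) / (l w - l u)) • (w - u) := by
        simp only [cross]; abel
      rw [this]
      exact W.add_mem h1 (W.smul_mem _ hwu)
    exact (W.smul_mem_iff (cross_coeff_pos hut hw't).ne').1 h2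
  have hlow : ∀ u' ∈ vert P, l u' < t → u' - u ∈ W := by
    intro u' hu' hu't
    have h1 : cross l t u' w - cross l t u w ∈ W :=
      Submodule.mem_sup_left (hsub _ (hcr u' hu' w hw hu't hwt) _ (hcr u hu w hw hut hwt))
    have h2 : (1 - (t - l u') / (l w - l u')) • (u' - u) ∈ W := by
      have : (1 - (t - l u') / (l w - l u')) • (u' - u) =
          (cross l t u' w - cross l t u w) +
            ((t - l u) / (l w - l u) - (t - l u') / (l w - l u')) • (w - u) := by
        simp only [cross]; module
      rw [this]
      exact W.add_mem h1 (W.smul_mem _ hwu)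
    exact (W.smul_mem_iff (sub_pos.2 (cross_coeff_lt_one hu't hwt)).ne').1 h2
  have hPW : ∀ x ∈ P, x - u ∈ W := by
    have hconv : Convex ℝ {x | x - u ∈ W} := by
      intro x hx y hy α β _ _ hαβ
      have : α • x + β • y - u = α • (x - u) + β • (y - u) := by
        rw [smul_sub, smul_sub, sub_add_sub_comm, ← add_smul, hαβ, one_smul]
      change α • x + β • y - u ∈ W
      rw [this]
      exact W.add_mem (W.smul_mem _ hx) (W.smul_mem _ hy)
    refine fun x hx => hP.subset_of_vert_subset hconv (fun v hv => ?_) hx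
    rcases lt_or_gt_of_ne (ht v hv) with h | h
    · exact hlow v hv h
    · exact hhigh v hv h
  have hAW : A ≤ W := by
    rw [hA, direction_affineSpan, vectorSpan_def, Submodule.span_le]
    rintro _ ⟨x, hx, y, hy, rfl⟩
    have := W.sub_mem (hPW x hx) (hPW y hy)
    simpa using this
  have h1 : Module.finrank ℝ A ≤ Module.finrank ℝ D + 1 :=
    (Submodule.finrank_mono hAW).trans ((Submodule.finrank_add_le_finrank_add_finrank _ _).trans
      (Nat.add_le_add_left ((finrank_span_le_card _).trans (by simp)) _))
  have h2 : Module.finrank ℝ D < Module.finrank ℝ A := Submodule.finrank_lt_finrank_of_lt hlt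
  change Module.finrank ℝ A = Module.finrank ℝ D + 1
  omega

end Cut

end Geometry

/-! ### The `ab`-index of a section -/

section Sections

variable {E : Type*} [NormedAddCommGroup E] [InnerProductSpace ℝ E]

/-- The contribution of `F` to the `ab`-index of a hyperplane section through `F`. -/
def sectionSum (P F : Set E) : ABPoly := (a - b) ^ (dim F - 1) * tail P F

lemma startSum_eq_mul_sectionSum {P F : Set E} (h : 0 < dim F) :
    startSum P F = (a - b) * sectionSum P F := by
  rw [startSum, sectionSum, ← mul_assoc, ← pow_succ', Nat.sub_add_cancel h]

lemma psi_empty : psi (∅ : Set E) = 0 := by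
  refine Finset.sum_eq_zero fun F hF => ?_
  have hP : IsPoly (∅ : Set E) := ⟨∅, by simp⟩
  have h := hP.mem_faces.1 hF
  exact absurd (h.2.mono h.subset) Set.not_nonempty_empty

variable [FiniteDimensional ℝ E]

lemma abIndex_eq_psi_of_isPolytope {P : Set E} (hP : IsPolytope P) : abIndex P = psi P :=
  abIndex_eq_psi hP.isPoly.faces_finite (isFace_self hP.1) fun _ hF hne => hF.dim_lt hne

section Cut

variable {P : Set E} (hP : IsPoly P) {l : StrongDual ℝ E} {t : ℝ} (ht : ∀ v ∈ vert P, l v ≠ t)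

include hP ht

omit [FiniteDimensional ℝ E] in
open Classical in
lemma sum_faces_inter_hyper (f : Set E → ABPoly) :
    ∑ G ∈ faces (P ∩ hyper l t), f G =
      ∑ F ∈ faces P with (F ∩ hyper l t).Nonempty, f (F ∩ hyper l t) := by
  have hQ := isPoly_inter_hyper hP ht
  symm
  refine Finset.sum_nbij (fun F => F ∩ hyper l t) ?_ ?_ ?_ fun _ _ => rfl
  · intro F hF
    rw [Finset.mem_filter, hP.mem_faces] at hF
    exact hQ.mem_faces.2 (hF.1.inter_hyper hF.2)
  · intro F hF G hG h
    rw [Finset.mem_coe, Finset.mem_filter, hP.mem_faces] at hF hG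
    exact hF.1.inter_hyper_inj hP ht hG.1 hF.2 h
  · intro G hG
    have hG' := hQ.mem_faces.1 hG
    obtain ⟨F, hF, rfl⟩ := exists_face_of_face_inter_hyper hP ht hG'
    exact ⟨F, Finset.mem_coe.2 (Finset.mem_filter.2 ⟨hP.mem_faces.2 hF, hG'.2⟩), rfl⟩

lemma IsFace.dim_inter_hyper {F : Set E} (hF : IsFace P F) (hne : (F ∩ hyper l t).Nonempty) :
    dim F = dim (F ∩ hyper l t) + 1 :=
  CDSweep.dim_inter_hyper (hF.isPoly hP) (IsFace.vert_ne ht hF) hne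

omit [FiniteDimensional ℝ E] in
lemma IsFace.ssubset_iff_inter_hyper {F G : Set E} (hF : IsFace P F)
    (hne : (F ∩ hyper l t).Nonempty) (hG : IsFace P G) :
    F ⊂ G ↔ (G ∩ hyper l t).Nonempty ∧ F ∩ hyper l t ⊂ G ∩ hyper l t := by
  constructor
  · intro h
    have hG' : (G ∩ hyper l t).Nonempty :=
      hne.mono (Set.inter_subset_inter_left _ h.subset)
    refine ⟨hG', Set.inter_subset_inter_left _ h.subset, fun h' => h.2 ?_⟩
    exact hG.subset_of_inter_hyper_subset hP ht hF hG' h'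
  · rintro ⟨-, h⟩
    exact ⟨hF.subset_of_inter_hyper_subset hP ht hG hne h.subset,
      fun h' => h.2 (Set.inter_subset_inter_left _ h')⟩

/-- Dimensions enter `chainSum` only as codimensions, and these survive cutting. Keeping `Y`
separate from the section of `X` also allows `X = {v}` and `Y = ∅` for a vertex figure. -/
lemma chainSum_inter_hyper (hne : (P ∩ hyper l t).Nonempty) (j : ℕ) (X Y : Set E)
    (hXY : ∀ F, IsFace P F → (X ⊂ F ↔ (F ∩ hyper l t).Nonempty ∧ Y ⊂ F ∩ hyper l t)) :
    chainSum P j X = chainSum (P ∩ hyper l t) j Y := by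
  classical
  have hdim := dim_inter_hyper hP ht hne
  induction j generalizing X Y with
  | zero => rfl
  | succ j ih =>
    rw [chainSum, chainSum, ih X Y hXY]
    congr 2
    rw [Finset.sum_filter, Finset.sum_filter, sum_faces_inter_hyper hP ht, Finset.sum_filter]
    refine Finset.sum_congr rfl fun F hF => ?_
    have hF' := hP.mem_faces.1 hF
    by_cases hFt : (F ∩ hyper l t).Nonempty
    · have hd := hF'.dim_inter_hyper hP ht hFt
      rw [if_pos hFt]
      refine if_congr ?_ (ih F (F ∩ hyper l t)
        fun G hG => hF'.ssubset_iff_inter_hyper hP ht hFt hG) rfl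
      rw [hXY F hF']
      constructor
      · rintro ⟨⟨_, h1⟩, h2⟩
        exact ⟨h1, by omega⟩
      · rintro ⟨h1, h2⟩
        exact ⟨⟨hFt, h1⟩, by omega⟩
    · rw [if_neg hFt, if_neg]
      rintro ⟨h1, -⟩
      exact hFt ((hXY F hF').1 h1).1

lemma IsFace.tail_inter_hyper {F : Set E} (hF : IsFace P F) (hne : (F ∩ hyper l t).Nonempty) :
    tail (P ∩ hyper l t) (F ∩ hyper l t) = tail P F := by
  have hPne : (P ∩ hyper l t).Nonempty := hne.mono (Set.inter_subset_inter_left _ hF.subset)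
  have hPP : IsFace P P := isFace_self (hPne.mono Set.inter_subset_left)
  unfold tail
  by_cases h : F = P
  · rw [if_pos h, if_pos (by rw [h])]
  · rw [if_neg h, if_neg fun h' => h (hF.inter_hyper_inj hP ht hPP hne h'),
      chainSum_inter_hyper hP ht hPne _ F (F ∩ hyper l t)
        fun G hG => hF.ssubset_iff_inter_hyper hP ht hne hG,
      hF.dim_inter_hyper hP ht hne, CDSweep.dim_inter_hyper hP ht hPne]
    congr 2
    omega

lemma IsFace.startSum_inter_hyper {F : Set E} (hF : IsFace P F)
    (hne : (F ∩ hyper l t).Nonempty) :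
    startSum (P ∩ hyper l t) (F ∩ hyper l t) = sectionSum P F := by
  rw [startSum, sectionSum, hF.tail_inter_hyper hP ht hne, hF.dim_inter_hyper hP ht hne,
    Nat.add_sub_cancel]

open Classical in
lemma psi_inter_hyper : psi (P ∩ hyper l t) =
    ∑ F ∈ faces P with (F ∩ hyper l t).Nonempty, sectionSum P F := by
  rw [psi, sum_faces_inter_hyper hP ht]
  refine Finset.sum_congr rfl fun F hF => ?_
  rw [Finset.mem_filter, hP.mem_faces] at hF
  exact hF.1.startSum_inter_hyper hP ht hF.2

end Cut

open Classical in
/-- The part of the `ab`-index of `P` coming from the chains that start strictly above the level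
`t` of the functional `p`. -/
def upperSum (P : Set E) (p : StrongDual ℝ E) (t : ℝ) : ABPoly :=
  ∑ F ∈ faces P with F ⊆ {x | t < p x}, startSum P F

omit [FiniteDimensional ℝ E] in
lemma IsPoly.subset_upper_iff {P : Set E} (hP : IsPoly P) (p : StrongDual ℝ E) (t : ℝ) :
    P ⊆ {x | t < p x} ↔ ∀ u ∈ vert P, t < p u :=
  ⟨fun h _ hu => h (vert_subset P hu), fun h =>
    hP.subset_of_vert_subset (convex_halfSpace_gt p.toLinearMap.isLinear _) h⟩

/-- Every face lies above the level, below it, or crosses it. A crossing face has positive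
dimension, so one factor `a - b` splits off and leaves the summand of its section. -/
lemma psi_eq_upperSum_add {P : Set E} (hP : IsPoly P) {p : StrongDual ℝ E} {t : ℝ}
    (ht : ∀ v ∈ vert P, p v ≠ t) :
    psi P = upperSum P p t + upperSum P (-p) (-t) + (a - b) * psi (P ∩ hyper p t) := by
  classical
  rw [psi_inter_hyper hP ht, upperSum, upperSum, psi, Finset.mul_sum, Finset.sum_filter,
    Finset.sum_filter, Finset.sum_filter, ← Finset.sum_add_distrib, ← Finset.sum_add_distrib]
  refine Finset.sum_congr rfl fun F hF => ?_
  have hF' := hP.mem_faces.1 hF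
  have hFp := hF'.isPoly hP
  have hFt := IsFace.vert_ne ht hF'
  obtain ⟨y, hy⟩ := hFp.vert_nonempty hF'.2
  simp only [hFp.subset_upper_iff, inter_hyper_nonempty_iff hFp hFt]
  simp only [_root_.neg_apply, neg_lt_neg_iff]
  by_cases h1 : ∀ u ∈ vert F, t < p u
  · have h2 : ¬ ∀ u ∈ vert F, p u < t := fun h => lt_asymm (h1 y hy) (h y hy)
    have h3 : ¬ ((∃ u ∈ vert F, p u < t) ∧ ∃ w ∈ vert F, t < p w) := by
      rintro ⟨⟨u, hu, hut⟩, -⟩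
      exact lt_asymm hut (h1 u hu)
    rw [if_pos h1, if_neg h2, if_neg h3, add_zero, add_zero]
  · by_cases h2 : ∀ u ∈ vert F, p u < t
    · have h3 : ¬ ((∃ u ∈ vert F, p u < t) ∧ ∃ w ∈ vert F, t < p w) := by
        rintro ⟨-, ⟨u, hu, hut⟩⟩
        exact lt_asymm hut (h2 u hu)
      rw [if_neg h1, if_pos h2, if_neg h3, add_zero, zero_add]
    · have h3 : (∃ u ∈ vert F, p u < t) ∧ ∃ w ∈ vert F, t < p w := by
        push Not at h1 h2
        obtain ⟨u, hu, hut⟩ := h1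
        obtain ⟨w, hw, hwt⟩ := h2
        exact ⟨⟨u, hu, lt_of_le_of_ne hut (hFt u hu)⟩,
          ⟨w, hw, lt_of_le_of_ne hwt (hFt w hw).symm⟩⟩
      have hdim : 0 < dim F := by
        have := dim_inter_hyper hFp hFt ((inter_hyper_nonempty_iff hFp hFt).2 h3)
        omega
      rw [if_neg h1, if_neg h2, if_pos h3, zero_add, zero_add, startSum_eq_mul_sectionSum hdim]

end Sections

/-! ### Vertex figures -/

section VertexFigures

variable {E : Type*} [NormedAddCommGroup E] [InnerProductSpace ℝ E]

/-- The hyperplane `k = s` strictly separates `v` from the other vertices of `P`. -/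
def Separates (P : Set E) (v : E) (k : StrongDual ℝ E) (s : ℝ) : Prop :=
  k v < s ∧ ∀ u ∈ vert P, u ≠ v → s < k u

/-- `v` lies in `F` and `p` is strictly larger at all the other vertices of `F`. -/
def IsBottom (p : StrongDual ℝ E) (v : E) (F : Set E) : Prop :=
  v ∈ F ∧ ∀ u ∈ vert F, u ≠ v → p v < p u

lemma Separates.vert_ne {P : Set E} {v : E} {k : StrongDual ℝ E} {s : ℝ}
    (h : Separates P v k s) : ∀ u ∈ vert P, k u ≠ s := fun u hu => by
  by_cases huv : u = v
  · rw [huv]; exact h.1.ne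
  · exact (h.2 u hu huv).ne'

section Figure

variable {P : Set E} (hP : IsPoly P) {v : E} (hv : v ∈ vert P) {k : StrongDual ℝ E} {s : ℝ}
  (h : Separates P v k s)

include hP hv h

lemma Separates.inter_hyper_nonempty_iff {F : Set E} (hF : IsFace P F) :
    (F ∩ hyper k s).Nonempty ↔ v ∈ F ∧ F ≠ {v} := by
  have hFp := hF.isPoly hP
  rw [CDSweep.inter_hyper_nonempty_iff hFp (IsFace.vert_ne h.vert_ne hF)]
  constructor
  · rintro ⟨⟨u, hu, hus⟩, ⟨w, hw, hws⟩⟩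
    have hu' := hF.vert_eq ▸ hu
    have huv : u = v := by
      by_contra hne
      exact lt_asymm hus (h.2 u hu'.2 hne)
    subst huv
    refine ⟨hu'.1, fun hFv => ?_⟩
    rw [hFv, vert_singleton] at hw
    rw [hw] at hws
    exact lt_asymm hus hws
  · rintro ⟨hvF, hne⟩
    have hvv : v ∈ vert F := hF.vert_eq ▸ ⟨hvF, hv⟩
    refine ⟨⟨v, hvv, h.1⟩, ?_⟩
    by_contra! hcon
    refine hne ?_
    have : vert F = {v} := by
      refine Set.Subset.antisymm (fun w hw => ?_) (by simpa using hvv)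
      by_contra hwv
      exact absurd (h.2 w (hF.vert_eq ▸ hw).2 hwv) (hcon w hw).not_gt
    rw [← hFp.convexHull_vert, this, convexHull_singleton]

omit hP in
lemma Separates.crossSet_eq {F : Set E} (hF : IsFace P F) (hvF : v ∈ F) :
    crossSet k s (vert F) = {x | ∃ w ∈ vert F, w ≠ v ∧ x = cross k s v w} := by
  ext x
  constructor
  · rintro ⟨u, hu, w, hw, h1, h2, rfl⟩
    have huv : u = v := by
      by_contra hne
      exact lt_asymm h1 (h.2 u (hF.vert_eq ▸ hu).2 hne)
    subst huv
    refine ⟨w, hw, ?_, rfl⟩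
    rintro rfl
    exact lt_asymm h1 h2
  · rintro ⟨w, hw, hne, rfl⟩
    exact ⟨v, hF.vert_eq ▸ ⟨hvF, hv⟩, w, hw, h.1, h.2 w (hF.vert_eq ▸ hw).2 hne, rfl⟩

/-- The section is spanned by interior points of the segments from `v` to the other vertices of `F`,
and `p` exceeds `p v` at such a point iff it does at the far end. -/
lemma Separates.inter_hyper_subset_upper_iff {F : Set E} (hF : IsFace P F) (hvF : v ∈ F)
    (p : StrongDual ℝ E) :
    F ∩ hyper k s ⊆ {x | p v < p x} ↔ IsBottom p v F := by
  have hFp := hF.isPoly hP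
  rw [inter_hyper_eq_convexHull hFp (IsFace.vert_ne h.vert_ne hF),
    h.crossSet_eq hv hF hvF]
  have key : ∀ w ∈ vert F, w ≠ v → (p v < p (cross k s v w) ↔ p v < p w) := by
    intro w hw hne
    have hpos := cross_coeff_pos h.1 (h.2 w (hF.vert_eq ▸ hw).2 hne)
    rw [apply_cross, lt_add_iff_pos_right, mul_pos_iff_of_pos_left hpos, sub_pos]
  constructor
  · exact fun hs => ⟨hvF, fun w hw hne =>
      (key w hw hne).1 (hs (subset_convexHull ℝ _ ⟨w, hw, hne, rfl⟩))⟩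
  · rintro ⟨-, hb⟩
    refine convexHull_min ?_ (convex_halfSpace_gt p.toLinearMap.isLinear _)
    rintro _ ⟨w, hw, hne, rfl⟩
    exact (key w hw hne).2 (hb w hw hne)

/-- This allows the vertex figure itself to be cut by the sweeping hyperplane through `v`. -/
lemma Separates.apply_vert_ne {p : StrongDual ℝ E} (hp : Set.InjOn p (vert P)) :
    ∀ w ∈ vert (P ∩ hyper k s), p w ≠ p v := by
  intro w hw
  obtain ⟨u, hu, w', hw', h1, h2, rfl⟩ := vert_inter_hyper_subset hP h.vert_ne hw
  have huv : u = v := by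
    by_contra hne
    exact lt_asymm h1 (h.2 u hu hne)
  subst huv
  have hpos := cross_coeff_pos h1 h2
  have hne : p w' - p u ≠ 0 := fun h0 => by
    have := hp hw' hu (sub_eq_zero.1 h0)
    subst this
    exact lt_asymm h1 h2
  rw [apply_cross]
  intro h0
  rcases mul_eq_zero.1 (add_eq_left.1 h0) with h3 | h3
  · exact hpos.ne' h3
  · exact hne h3

variable [FiniteDimensional ℝ E]

open Classical in
-- The faces of the vertex figure above the level of `v` are the sections of the faces with lowest
-- vertex `v`. Only `{v}` has an empty section, hence the `0`.
lemma Separates.upperSum_inter_hyper (p : StrongDual ℝ E) :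
    upperSum (P ∩ hyper k s) p (p v) =
      ∑ F ∈ faces P with IsBottom p v F, if F.Subsingleton then 0 else sectionSum P F := by
  rw [upperSum, Finset.sum_filter, Finset.sum_filter, sum_faces_inter_hyper hP h.vert_ne,
    Finset.sum_filter]
  refine Finset.sum_congr rfl fun F hF => ?_
  have hF' := hP.mem_faces.1 hF
  by_cases hb : IsBottom p v F
  · rw [if_pos hb]
    have hiff := h.inter_hyper_nonempty_iff hP hv hF'
    by_cases hs : F.Subsingleton
    · rw [if_pos hs, if_neg]
      intro h1
      exact (hiff.1 h1).2 (hs.eq_singleton_of_mem hb.1)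
    · have h1 := hiff.2 ⟨hb.1, fun h2 => hs (h2 ▸ Set.subsingleton_singleton)⟩
      rw [if_neg hs, if_pos h1, if_pos ((h.inter_hyper_subset_upper_iff hP hv hF' hb.1 p).2 hb),
        hF'.startSum_inter_hyper hP h.vert_ne h1]
  · rw [if_neg hb]
    split_ifs with h1 h2
    · exact absurd ((h.inter_hyper_subset_upper_iff hP hv hF'
        ((h.inter_hyper_nonempty_iff hP hv hF').1 h1).1 p).1 h2) hb
    · rfl
    · rfl

omit [FiniteDimensional ℝ E] in
lemma Separates.nonempty_inter_hyper (hdim : 0 < dim P) : (P ∩ hyper k s).Nonempty := by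
  have hvP := vert_subset P hv
  refine (h.inter_hyper_nonempty_iff hP hv (isFace_self ⟨v, hvP⟩)).2 ⟨hvP, fun h0 => ?_⟩
  rw [h0, dim_singleton] at hdim
  exact lt_irrefl _ hdim

omit [FiniteDimensional ℝ E] in
lemma Separates.isPolytope_inter_hyper (hdim : 0 < dim P) : IsPolytope (P ∩ hyper k s) :=
  ⟨h.nonempty_inter_hyper hP hv hdim, isPoly_inter_hyper hP h.vert_ne⟩

/-- The letter `b` records `{v}`; the faces strictly containing `v` correspond to the nonempty faces
of the vertex figure. -/
lemma Separates.startSum_singleton (hdim : 0 < dim P) :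
    startSum P {v} = b * psi (P ∩ hyper k s) := by
  have hQ := h.isPolytope_inter_hyper hP hv hdim
  have hd := dim_inter_hyper hP h.vert_ne hQ.1
  have hne : ({v} : Set E) ≠ P := by
    intro h0
    rw [← h0, dim_singleton] at hdim
    exact lt_irrefl _ hdim
  rw [startSum, tail, if_neg hne, dim_singleton, pow_zero, one_mul,
    ← abIndex_eq_psi_of_isPolytope hQ, abIndex_eq_chainSum hQ.isPoly.faces_finite,
    chainSum_inter_hyper hP h.vert_ne hQ.1 _ {v} ∅]
  · congr 2
    omega
  · intro F hF
    constructor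
    · intro hs
      have := (h.inter_hyper_nonempty_iff hP hv hF).2 ⟨hs.subset rfl, hs.ne'⟩
      exact ⟨this, Set.empty_ssubset.2 this⟩
    · rintro ⟨hne, -⟩
      have := (h.inter_hyper_nonempty_iff hP hv hF).1 hne
      exact lt_of_le_of_ne (Set.singleton_subset_iff.2 this.1) this.2.symm

end Figure

/-! ### The sweeping recursion -/

section Sweeping

variable {P : Set E} (hP : IsPoly P) {p : StrongDual ℝ E} (hp : Set.InjOn p (vert P))

include hP hp

lemma IsFace.exists_isBottom {F : Set E} (hF : IsFace P F) : ∃ v ∈ vert P, IsBottom p v F := by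
  have hFp := hF.isPoly hP
  obtain ⟨v, hv, hmin⟩ := Set.exists_min_image _ p hFp.vert_finite (hFp.vert_nonempty hF.2)
  have hv' := hF.vert_eq ▸ hv
  refine ⟨v, hv'.2, hv'.1, fun u hu hne => lt_of_le_of_ne (hmin u hu) fun h0 => hne ?_⟩
  exact (hp hv'.2 (hF.vert_eq ▸ hu).2 h0).symm

omit hP hp in
lemma IsBottom.unique {F : Set E} (hF : IsFace P F) {u v : E} (hu : u ∈ vert P)
    (hv : v ∈ vert P) (hbu : IsBottom p u F) (hbv : IsBottom p v F) : u = v := by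
  by_contra hne
  exact lt_asymm (hbu.2 v (hF.vert_eq ▸ ⟨hbv.1, hv⟩) (Ne.symm hne))
    (hbv.2 u (hF.vert_eq ▸ ⟨hbu.1, hu⟩) hne)

omit hp in
open Classical in
lemma sum_sum_isBottom (q : E → Prop) (f : Set E → ABPoly) :
    ∑ v ∈ hP.vert_finite.toFinset with q v, ∑ F ∈ faces P with IsBottom p v F, f F =
      ∑ F ∈ faces P with ∃ v ∈ vert P, IsBottom p v F ∧ q v, f F := by
  rw [← Finset.sum_biUnion]
  · refine Finset.sum_congr ?_ fun _ _ => rfl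
    ext F
    simp only [Finset.mem_biUnion, Finset.mem_filter, Set.Finite.mem_toFinset]
    constructor
    · rintro ⟨v, ⟨h1, h2⟩, h3, h4⟩
      exact ⟨h3, v, h1, h4, h2⟩
    · rintro ⟨h3, v, h1, h4, h2⟩
      exact ⟨v, ⟨h1, h2⟩, h3, h4⟩
  · intro u hu v hv hne
    simp only [Finset.coe_filter, Set.Finite.mem_toFinset, Set.mem_ofPred_eq] at hu hv
    rw [Function.onFun, Finset.disjoint_filter]
    intro F hF hbu hbv
    exact hne (IsBottom.unique (hP.mem_faces.1 hF) hu.1 hv.1 hbu hbv)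

lemma IsFace.exists_isBottom_lt_iff {F : Set E} (hF : IsFace P F) (t : ℝ) :
    (∃ v ∈ vert P, IsBottom p v F ∧ t < p v) ↔ ∀ u ∈ vert F, t < p u := by
  constructor
  · rintro ⟨v, -, hb, hvt⟩ u hu
    by_cases huv : u = v
    · rwa [huv]
    · exact hvt.trans (hb.2 u hu huv)
  · intro h
    obtain ⟨v, hv, hb⟩ := hF.exists_isBottom hP hp
    exact ⟨v, hv, hb, h v (hF.vert_eq ▸ ⟨hb.1, hv⟩)⟩

lemma IsFace.exists_isTop_lt_iff {F : Set E} (hF : IsFace P F) (t : ℝ) :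
    (∃ v ∈ vert P, IsBottom (-p) v F ∧ t < p v) ↔ ∃ u ∈ vert F, t < p u := by
  have hp' : Set.InjOn (-p) (vert P) := fun u hu v hv h => hp hu hv (by simpa using h)
  constructor
  · rintro ⟨v, hv, hb, hvt⟩
    exact ⟨v, hF.vert_eq ▸ ⟨hb.1, hv⟩, hvt⟩
  · rintro ⟨u, hu, hut⟩
    obtain ⟨v, hv, hb⟩ := hF.exists_isBottom hP hp'
    refine ⟨v, hv, hb, ?_⟩
    by_cases huv : u = v
    · rwa [← huv]
    · have := hb.2 u hu huv
      simp only [_root_.neg_apply, neg_lt_neg_iff] at this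
      exact hut.trans this

variable [FiniteDimensional ℝ E]

variable {k : E → StrongDual ℝ E} {s : E → ℝ} (h : ∀ v ∈ vert P, Separates P v (k v) (s v))

include h

open Classical in
-- A face lies above the level iff its lowest vertex does. For each `v`, the face `{v}` gives the
-- first term and the larger faces with lowest vertex `v` give the second.
lemma upperSum_eq_sum_vert (hdim : 0 < dim P) (t : ℝ) :
    upperSum P p t = ∑ v ∈ hP.vert_finite.toFinset with t < p v,
      (b * psi (P ∩ hyper (k v) (s v)) +
        (a - b) * upperSum (P ∩ hyper (k v) (s v)) p (p v)) := by
  have h1 : upperSum P p t = ∑ F ∈ faces P with ∃ v ∈ vert P, IsBottom p v F ∧ t < p v,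
      startSum P F := by
    refine Finset.sum_congr (Finset.filter_congr fun F hF => ?_) fun _ _ => rfl
    have hF' := hP.mem_faces.1 hF
    rw [hF'.exists_isBottom_lt_iff hP hp, (hF'.isPoly hP).subset_upper_iff]
  rw [h1, ← sum_sum_isBottom hP]
  refine Finset.sum_congr rfl fun v hv => ?_
  have hv' : v ∈ vert P := by simpa using (Finset.mem_filter.1 hv).1
  rw [(h v hv').upperSum_inter_hyper hP hv' p, ← (h v hv').startSum_singleton hP hv' hdim,
    Finset.mul_sum]
  have hmem : {v} ∈ (faces P).filter (fun F => IsBottom p v F) :=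
    Finset.mem_filter.2 ⟨hP.mem_faces.2 (hP.isFace_singleton hv'), rfl, fun u hu hne => by
      rw [vert_singleton] at hu
      exact absurd hu hne⟩
  rw [← Finset.add_sum_erase _ _ hmem, ← Finset.add_sum_erase _ _ hmem,
    if_pos Set.subsingleton_singleton, mul_zero, zero_add]
  congr 1
  refine Finset.sum_congr rfl fun F hF => ?_
  obtain ⟨hne, hF2⟩ := Finset.mem_erase.1 hF
  obtain ⟨hF3, hb⟩ := Finset.mem_filter.1 hF2
  have hF' := hP.mem_faces.1 hF3
  have hns : ¬ F.Subsingleton := fun h => hne (h.eq_singleton_of_mem hb.1)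
  rw [if_neg hns, startSum_eq_mul_sectionSum]
  refine Nat.pos_of_ne_zero fun h0 => ?_
  obtain ⟨x, rfl⟩ := exists_eq_singleton_of_dim_eq_zero hF'.2 h0
  exact hns Set.subsingleton_singleton

open Classical in
-- The two terms count the faces whose highest, respectively lowest, vertex is `v`. Summed over the
-- vertices above `t`, a face entirely above cancels, and the crossing faces remain.
lemma psi_inter_hyper_eq_sum_vert {t : ℝ} (ht : ∀ v ∈ vert P, p v ≠ t) :
    psi (P ∩ hyper p t) = ∑ v ∈ hP.vert_finite.toFinset with t < p v,
      (upperSum (P ∩ hyper (k v) (s v)) (-p) (-p v) -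
        upperSum (P ∩ hyper (k v) (s v)) p (p v)) := by
  have h1 : ∀ v ∈ hP.vert_finite.toFinset.filter (fun v => t < p v),
      (upperSum (P ∩ hyper (k v) (s v)) (-p) (-p v) -
        upperSum (P ∩ hyper (k v) (s v)) p (p v)) =
      (∑ F ∈ faces P with IsBottom (-p) v F, if F.Subsingleton then 0 else sectionSum P F) -
        ∑ F ∈ faces P with IsBottom p v F, if F.Subsingleton then 0 else sectionSum P F := by
    intro v hv
    have hv' : v ∈ vert P := by simpa using (Finset.mem_filter.1 hv).1
    rw [← (h v hv').upperSum_inter_hyper hP hv' p, ← (h v hv').upperSum_inter_hyper hP hv' (-p)]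
    rfl
  rw [Finset.sum_congr rfl h1, Finset.sum_sub_distrib, sum_sum_isBottom hP,
    sum_sum_isBottom hP, psi_inter_hyper hP ht, Finset.sum_filter, Finset.sum_filter,
    Finset.sum_filter, ← Finset.sum_sub_distrib]
  refine Finset.sum_congr rfl fun F hF => ?_
  have hF' := hP.mem_faces.1 hF
  have hFp := hF'.isPoly hP
  have hFt := IsFace.vert_ne ht hF'
  obtain ⟨y, hy⟩ := hFp.vert_nonempty hF'.2
  simp only [hF'.exists_isBottom_lt_iff hP hp, hF'.exists_isTop_lt_iff hP hp,
    inter_hyper_nonempty_iff hFp hFt]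
  by_cases hall : ∀ u ∈ vert F, t < p u
  · have h2 : ¬ ((∃ u ∈ vert F, p u < t) ∧ ∃ w ∈ vert F, t < p w) := by
      rintro ⟨⟨u, hu, hut⟩, -⟩
      exact lt_asymm hut (hall u hu)
    have h3 : ∃ w ∈ vert F, t < p w := ⟨y, hy, hall y hy⟩
    rw [if_neg h2, if_pos hall, if_pos h3, sub_self]
  · rw [if_neg hall, sub_zero]
    by_cases h3 : ∃ w ∈ vert F, t < p w
    · have h4 : ∃ u ∈ vert F, p u < t := by
        push Not at hall
        obtain ⟨u, hu, hut⟩ := hall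
        exact ⟨u, hu, lt_of_le_of_ne hut (hFt u hu)⟩
      rw [if_pos ⟨h4, h3⟩, if_pos h3, if_neg]
      intro hsub
      obtain ⟨w, hw, hwt⟩ := h3
      obtain ⟨u, hu, hut⟩ := h4
      rw [hsub (vert_subset F hu) (vert_subset F hw)] at hut
      exact lt_asymm hut hwt
    · rw [if_neg h3, if_neg fun h => h3 h.2]

omit hP hp h in
/-- The part of the `ab`-index of `P` swept above the level `t`, corrected along the
sweeping hyperplane so as to become a polynomial in `a + b` and `ab + ba`. -/
def sweptPart (P : Set E) (p : StrongDual ℝ E) (t : ℝ) : ABPoly :=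
  upperSum P p t - b * psi (P ∩ hyper p t)

open Classical in
-- Let U, L and R be the upper part, the lower part and the psi of the section of the vertex figure
-- at the level of `v`. The summand is b(U + L + (a - b)R) + (a - b)U - b(L - U) = (a + b)U + b(a -
-- b)R, which equals (ab + ba)R + (a + b)(U - bR).
theorem sweptPart_eq_sum_vert (hdim : 0 < dim P) {t : ℝ} (ht : ∀ v ∈ vert P, p v ≠ t) :
    sweptPart P p t = ∑ v ∈ hP.vert_finite.toFinset with t < p v,
      ((a * b + b * a) * psi (P ∩ hyper (k v) (s v) ∩ hyper p (p v)) +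
        (a + b) * sweptPart (P ∩ hyper (k v) (s v)) p (p v)) := by
  rw [sweptPart, upperSum_eq_sum_vert hP hp h hdim, psi_inter_hyper_eq_sum_vert hP hp h ht,
    Finset.mul_sum, ← Finset.sum_sub_distrib]
  refine Finset.sum_congr rfl fun v hv => ?_
  have hv' : v ∈ vert P := by simpa using (Finset.mem_filter.1 hv).1
  have hsep := h v hv'
  rw [sweptPart, psi_eq_upperSum_add (isPoly_inter_hyper hP hsep.vert_ne)
    (hsep.apply_vert_ne hP hv' hp)]
  noncomm_ring

end Sweeping

end VertexFigures

/-! ### Existence of the `cd`-index and the sweep formula -/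

section CDIndex

variable {E : Type*} [NormedAddCommGroup E] [InnerProductSpace ℝ E] [FiniteDimensional ℝ E]

omit [FiniteDimensional ℝ E] in
lemma sweptPart_eq_psi {P : Set E} (hP : IsPoly P) {p : StrongDual ℝ E} {t : ℝ}
    (h : ∀ v ∈ vert P, t < p v) : sweptPart P p t = psi P := by
  classical
  have hsub := (hP.subset_upper_iff p t).2 h
  have h0 : P ∩ hyper p t = ∅ := by
    ext x
    simp only [Set.mem_inter_iff, Set.mem_empty_iff_false, iff_false]
    rintro ⟨h1, h2⟩
    exact (hsub h1).ne h2.symm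
  rw [sweptPart, h0, psi_empty, mul_zero, sub_zero, upperSum, psi, Finset.filter_true_of_mem]
  exact fun F hF => (hP.mem_faces.1 hF).subset.trans hsub

/-- Which faces lie above or cross the level depends only on the sides of their vertices. This
permits perturbing `p`. -/
lemma sweptPart_congr {P : Set E} (hP : IsPoly P) {p q : StrongDual ℝ E} {t : ℝ}
    (hp : ∀ v ∈ vert P, p v ≠ t) (hq : ∀ v ∈ vert P, q v ≠ t)
    (h : ∀ v ∈ vert P, (t < p v ↔ t < q v)) : sweptPart P p t = sweptPart P q t := by
  classical
  have h' : ∀ v ∈ vert P, (p v < t ↔ q v < t) := fun v hv => by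
    rw [lt_iff_le_and_ne, lt_iff_le_and_ne, ← not_lt, ← not_lt, h v hv]
    simp [hp v hv, hq v hv]
  rw [sweptPart, sweptPart, psi_inter_hyper hP hp, psi_inter_hyper hP hq, upperSum, upperSum]
  congr 1
  · refine Finset.sum_congr (Finset.filter_congr fun F hF => ?_) fun _ _ => rfl
    have hF' := hP.mem_faces.1 hF
    rw [(hF'.isPoly hP).subset_upper_iff, (hF'.isPoly hP).subset_upper_iff]
    exact forall₂_congr fun v hv => h v (hF'.vert_eq ▸ hv).2
  · congr 1
    refine Finset.sum_congr (Finset.filter_congr fun F hF => ?_) fun _ _ => rfl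
    have hF' := hP.mem_faces.1 hF
    rw [inter_hyper_nonempty_iff (hF'.isPoly hP) (IsFace.vert_ne hp hF'),
      inter_hyper_nonempty_iff (hF'.isPoly hP) (IsFace.vert_ne hq hF')]
    refine and_congr ?_ ?_
    · exact exists_congr fun v => and_congr_right fun hv => h' v (hF'.vert_eq ▸ hv).2
    · exact exists_congr fun v => and_congr_right fun hv => h v (hF'.vert_eq ▸ hv).2

omit [FiniteDimensional ℝ E] in
lemma isPoly_singleton (v : E) : IsPoly ({v} : Set E) := ⟨{v}, by simp⟩

omit [FiniteDimensional ℝ E] in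
open Classical in
lemma sweptPart_singleton {v : E} {p : StrongDual ℝ E} {t : ℝ} (h : p v ≠ t) :
    sweptPart {v} p t = if t < p v then 1 else 0 := by
  have hP := isPoly_singleton v
  have hf : faces ({v} : Set E) = {{v}} := by
    ext F
    rw [hP.mem_faces, Finset.mem_singleton]
    constructor
    · exact fun hF => (Set.subset_singleton_iff_eq.1 hF.subset).resolve_left hF.2.ne_empty
    · rintro rfl
      exact isFace_self ⟨v, rfl⟩
  have h0 : {v} ∩ hyper p t = ∅ := by
    ext x
    simp only [Set.mem_inter_iff, Set.mem_empty_iff_false, iff_false]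
    rintro ⟨rfl, h2⟩
    exact h h2
  rw [sweptPart, h0, psi_empty, mul_zero, sub_zero, upperSum, hf, Finset.sum_filter,
    Finset.sum_singleton]
  simp [startSum, tail, dim_singleton]

lemma exists_injOn_of_finite {V : Set E} (hV : V.Finite) (p : StrongDual ℝ E) {t : ℝ}
    (ht : ∀ v ∈ V, p v ≠ t) : ∃ q : StrongDual ℝ E, Set.InjOn q V ∧
      ∀ v ∈ V, q v ≠ t ∧ (t < p v ↔ t < q v) := by
  have : Finite V := hV.to_subtype
  obtain ⟨f, hf⟩ := Module.exists_dual_forall_apply_ne_zero (K := ℝ)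
    (fun x : {x : V × V // x.1 ≠ x.2} => (x.1.1 - x.1.2 : E))
    fun x => sub_ne_zero.2 fun h => x.2 (Subtype.ext h)
  set g : StrongDual ℝ E := LinearMap.toContinuousLinearMap f with hg
  have hcont : ∀ x : E, Filter.Tendsto (fun ε : ℝ => (p + ε • g) x) (nhdsWithin 0 (Set.Ioi 0))
      (nhds (p x)) := by
    intro x
    have : Continuous fun ε : ℝ => p x + ε * g x := by fun_prop
    have := (this.tendsto 0).mono_left (nhdsWithin_le_nhds (s := Set.Ioi 0))
    simpa using this
  have hinj : ∀ x : {x : V × V // x.1 ≠ x.2}, ∀ᶠ ε : ℝ in nhdsWithin 0 (Set.Ioi 0),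
      (p + ε • g) (x.1.1 - x.1.2 : E) ≠ 0 := by
    intro x
    -- A difference killed by `p` is detected by `g` for every positive `ε`; any other stays nonzero
    -- for small `ε` by continuity.
    by_cases h0 : p (x.1.1 - x.1.2 : E) = 0
    · filter_upwards [self_mem_nhdsWithin] with ε hε
      have : g (x.1.1 - x.1.2 : E) ≠ 0 := hf x
      simp only [_root_.add_apply, h0, _root_.smul_apply, zero_add, smul_eq_mul]
      exact mul_ne_zero (ne_of_gt hε) this
    · exact (hcont _).eventually_ne h0
  have hsign : ∀ v : V, ∀ᶠ ε : ℝ in nhdsWithin 0 (Set.Ioi 0),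
      (p + ε • g) v ≠ t ∧ (t < p v ↔ t < (p + ε • g) (v : E)) := by
    intro v
    rcases lt_or_gt_of_ne (ht v v.2) with h | h
    · filter_upwards [(hcont v).eventually_lt_const h] with ε hε
      exact ⟨hε.ne, fun h1 => absurd h1 h.not_gt, fun h1 => absurd h1 hε.not_gt⟩
    · filter_upwards [(hcont v).eventually_const_lt h] with ε hε
      exact ⟨hε.ne', fun _ => hε, fun _ => h⟩
  obtain ⟨ε, h1, h2⟩ :=
    ((Filter.eventually_all.2 hinj).and (Filter.eventually_all.2 hsign)).exists
  refine ⟨p + ε • g, fun u hu w hw huw => ?_, fun v hv => h2 ⟨v, hv⟩⟩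
  by_contra hne
  refine h1 ⟨(⟨u, hu⟩, ⟨w, hw⟩), fun h => hne (congrArg Subtype.val h)⟩ ?_
  rw [map_sub, sub_eq_zero]
  exact huw

omit [FiniteDimensional ℝ E] in
lemma psi_mem_range_of_sweptPart {P : Set E} (hP : IsPoly P)
    (h : P.Nonempty → ∀ (p : StrongDual ℝ E) (t : ℝ), (∀ v ∈ vert P, p v ≠ t) →
      sweptPart P p t ∈ cdToAB.range) : psi P ∈ cdToAB.range := by
  rcases P.eq_empty_or_nonempty with rfl | hne
  · rw [psi_empty]
    exact zero_mem _
  · rw [← sweptPart_eq_psi hP (p := 0) (t := -1) (by simp)]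
    exact h hne 0 (-1) (by simp)

/-- Strong induction is needed because the recursion involves both the vertex figure and its
section, of dimension one and two less. -/
lemma sweptPart_mem_range {P : Set E} (hP : IsPolytope P) (p : StrongDual ℝ E) {t : ℝ}
    (ht : ∀ v ∈ vert P, p v ≠ t) : sweptPart P p t ∈ cdToAB.range := by
  classical
  induction hn : dim P using Nat.strong_induction_on generalizing P p t with
  | _ n ih =>
    have hPp := hP.isPoly
    rcases Nat.eq_zero_or_pos (dim P) with h0 | hdim
    · obtain ⟨v, rfl⟩ := exists_eq_singleton_of_dim_eq_zero hP.1 h0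
      rw [sweptPart_singleton (ht v (by rw [vert_singleton]; rfl))]
      split_ifs
      · exact one_mem _
      · exact zero_mem _
    · obtain ⟨q, hq, hqt⟩ := exists_injOn_of_finite hPp.vert_finite p ht
      have hsep : ∀ v, ∃ (k : StrongDual ℝ E) (s : ℝ), v ∈ vert P → Separates P v k s := by
        intro v
        by_cases hv : v ∈ vert P
        · obtain ⟨k, s, h⟩ := hPp.exists_truncation hv
          exact ⟨k, s, fun _ => h⟩
        · exact ⟨0, 0, fun h => absurd h hv⟩
      choose k s hks using hsep
      rw [sweptPart_congr hPp ht (fun v hv => (hqt v hv).1) fun v hv => (hqt v hv).2,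
        sweptPart_eq_sum_vert hPp hq hks hdim fun v hv => (hqt v hv).1]
      refine sum_mem fun v hv => ?_
      have hv' : v ∈ vert P := by simpa using (Finset.mem_filter.1 hv).1
      have hsep := hks v hv'
      have hQ := hsep.isPolytope_inter_hyper hPp hv' hdim
      have hQd := dim_inter_hyper hPp hsep.vert_ne hQ.1
      have hQv := hsep.apply_vert_ne hPp hv' hq
      have hR := isPoly_inter_hyper hQ.isPoly hQv
      refine add_mem (mul_mem ⟨d, cdToAB_d⟩ ?_) (mul_mem ⟨c, cdToAB_c⟩ ?_)
      · refine psi_mem_range_of_sweptPart hR fun hne p' t' ht' => ?_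
        have hRd := dim_inter_hyper hQ.isPoly hQv hne
        exact ih _ (by omega) ⟨hne, hR⟩ p' ht' rfl
      · exact ih _ (by omega) hQ q hQv rfl

lemma exists_cdToAB_eq_abIndex {P : Set E} (hP : IsPolytope P) :
    ∃ φ : CDPoly, cdToAB φ = abIndex P := by
  rw [abIndex_eq_psi_of_isPolytope hP]
  exact psi_mem_range_of_sweptPart hP.isPoly fun _ p t ht => sweptPart_mem_range hP p ht

/-- The convention for the empty set agrees with `psi_empty`, so an empty R_v needs no separate
treatment. -/
lemma cdToAB_cdIndex {P : Set E} (hP : IsPoly P) : cdToAB (cdIndex P) = psi P := by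
  rcases P.eq_empty_or_nonempty with rfl | hne
  · rw [psi_empty, cdIndex, dif_neg fun h => Set.not_nonempty_empty h.1, map_zero]
  · have h : P.Nonempty ∧ ∃ φ : CDPoly, cdToAB φ = abIndex P :=
      ⟨hne, exists_cdToAB_eq_abIndex ⟨hne, hP⟩⟩
    rw [cdIndex, dif_pos h, h.2.choose_spec, abIndex_eq_psi_of_isPolytope ⟨hne, hP⟩]

namespace Sweep

variable (σ : Sweep E)

omit [FiniteDimensional ℝ E] in
lemma Truncates.separates {σ : Sweep E} {P : Set E} {v : E} (h : σ.Truncates P v) :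
    Separates P v (innerSL ℝ (σ.normal P v)) (σ.level P v) := h

omit [FiniteDimensional ℝ E] in
lemma Q_eq (P : Set E) (v : E) :
    σ.Q P v = P ∩ hyper (innerSL ℝ (σ.normal P v)) (σ.level P v) := rfl

omit [FiniteDimensional ℝ E] in
lemma R_eq (P : Set E) (v : E) :
    σ.R P v = σ.Q P v ∩ hyper (innerSL ℝ σ.p) (innerSL ℝ σ.p v) := rfl

omit [FiniteDimensional ℝ E] in
open Classical in
lemma finsum_vert_upper {P : Set E} (hP : IsPoly P) (v : E) (f : E → CDPoly) :
    ∑ᶠ w ∈ vert P ∩ σ.upper v, f w =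
      ∑ w ∈ hP.vert_finite.toFinset with innerSL ℝ σ.p v < innerSL ℝ σ.p w, f w := by
  rw [← finsum_mem_coe_finset]
  congr! 3 with w
  rw [Finset.mem_coe, Finset.mem_filter, Set.Finite.mem_toFinset]
  rfl

open Classical in
-- Both sides satisfy the same recursion. The level is left free because the induction hypothesis is
-- applied to each vertex figure at the level of its own vertex.
lemma cdToAB_sum_portionAux (m : ℕ) {P : Set E} (hP : IsPolytope P) (hm : dim P = m)
    (hσ : σ.GenericAux m P) {t : ℝ} (ht : ∀ v ∈ vert P, innerSL ℝ σ.p v ≠ t) :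
    cdToAB (∑ v ∈ hP.isPoly.vert_finite.toFinset with t < innerSL ℝ σ.p v,
      σ.portionAux m P v) = sweptPart P (innerSL ℝ σ.p) t := by
  induction m generalizing P t with
  | zero =>
    obtain ⟨v, rfl⟩ := exists_eq_singleton_of_dim_eq_zero hP.1 hm
    have hv : v ∈ vert ({v} : Set E) := by rw [vert_singleton]; rfl
    have hV : hP.isPoly.vert_finite.toFinset = {v} := by
      ext x
      simp [vert_singleton]
    rw [hV, sweptPart_singleton (ht v hv), Finset.sum_filter, Finset.sum_singleton]
    split_ifs <;> simp [portionAux]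
  | succ m ih =>
    have hdim : 0 < dim P := by omega
    rw [sweptPart_eq_sum_vert hP.isPoly hσ.1 (fun v hv => (hσ.2 v hv).1.separates) hdim ht,
      map_sum]
    refine Finset.sum_congr rfl fun v hv => ?_
    have hv' : v ∈ vert P := by simpa using (Finset.mem_filter.1 hv).1
    have hsep := (hσ.2 v hv').1.separates
    have hQ := hsep.isPolytope_inter_hyper hP.isPoly hv' hdim
    have hQd := dim_inter_hyper hP.isPoly hsep.vert_ne hQ.1
    have hQv := hsep.apply_vert_ne hP.isPoly hv' (p := innerSL ℝ σ.p) hσ.1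
    have hR := isPoly_inter_hyper hQ.isPoly hQv
    rw [portionAux, map_add, map_mul, cdToAB_d, R_eq, Q_eq, cdToAB_cdIndex hR,
      σ.finsum_vert_upper hQ.isPoly, ← Finset.mul_sum, map_mul, cdToAB_c,
      ih hQ (by omega) (hσ.2 v hv').2 hQv]

theorem cdIndex_eq_sum_portion {P : Set E} (hP : IsPolytope P) (hσ : σ.Generic P) :
    cdIndex P = ∑ᶠ v ∈ vert P, σ.portion P v := by
  classical
  apply cdToAB_injective
  have hfin := hP.isPoly.vert_finite
  -- From a level strictly below all vertices, the swept part is all of `psi P`.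
  obtain ⟨t, ht⟩ : ∃ t, ∀ v ∈ vert P, t < innerSL ℝ σ.p v := by
    obtain ⟨t, ht⟩ := (hfin.image (innerSL ℝ σ.p)).bddBelow
    exact ⟨t - 1, fun v hv => by linarith [ht ⟨v, hv, rfl⟩]⟩
  rw [cdToAB_cdIndex hP.isPoly, ← sweptPart_eq_psi hP.isPoly ht,
    ← σ.cdToAB_sum_portionAux (dim P) hP rfl hσ fun v hv => (ht v hv).ne',
    finsum_mem_eq_finite_toFinset_sum _ hfin, Finset.filter_true_of_mem]
  · rfl
  · exact fun v hv => ht v (by simpa using hv)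

theorem portion_eq {P : Set E} (hP : IsPolytope P) (hσ : σ.Generic P) (hdim : 0 < dim P) {v : E}
    (hv : v ∈ vert P) : σ.portion P v = d * cdIndex (σ.R P v) +
      ∑ᶠ w ∈ vert (σ.Q P v) ∩ σ.upper v, c * σ.portion (σ.Q P v) w := by
  obtain ⟨m, hm⟩ := Nat.exists_eq_succ_of_ne_zero hdim.ne'
  unfold Generic at hσ
  rw [hm] at hσ
  have hsep := (hσ.2 v hv).1.separates
  have hQ := hsep.isPolytope_inter_hyper hP.isPoly hv hdim
  have hQd := dim_inter_hyper hP.isPoly hsep.vert_ne hQ.1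
  -- `portionAux` counts down a number, so unfolding yields portions of the vertex figure only once
  -- its dimension is known to be `m`.
  have hQm : dim (σ.Q P v) = m := by
    rw [Q_eq]
    omega
  unfold portion
  rw [hm, hQm]
  rfl

theorem exists_vert_eq_singleton {P : Set E} (hP : IsPolytope P) (h0 : dim P = 0) :
    ∃ v, vert P = {v} ∧ σ.portion P v = 1 ∧ cdIndex P = 1 := by
  obtain ⟨v, rfl⟩ := exists_eq_singleton_of_dim_eq_zero hP.1 h0
  have hσ : σ.Generic {v} := by
    unfold Generic
    rw [h0]
    trivial
  have hpor : σ.portion {v} v = 1 := by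
    unfold portion
    rw [h0]
    rfl
  refine ⟨v, vert_singleton v, hpor, ?_⟩
  rw [σ.cdIndex_eq_sum_portion hP hσ, vert_singleton, finsum_mem_singleton, hpor]

end Sweep

end CDIndex

end CDSweep

end

theorem theorem3p2 {n : ℕ} (P : Set (EuclideanSpace ℝ (Fin n))) (hP : CDSweep.IsPolytope P) :
    (∃! φ : CDSweep.CDPoly, CDSweep.cdToAB φ = CDSweep.abIndex P) ∧
    ∀ σ : CDSweep.Sweep (EuclideanSpace ℝ (Fin n)), σ.Generic P →
      (CDSweep.dim P = 0 →
        ∃ v, CDSweep.vert P = {v} ∧ σ.portion P v = 1 ∧ CDSweep.cdIndex P = 1) ∧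
      (0 < CDSweep.dim P →
        (∀ v ∈ CDSweep.vert P,
          σ.portion P v = CDSweep.d * CDSweep.cdIndex (σ.R P v) +
            ∑ᶠ w ∈ CDSweep.vert (σ.Q P v) ∩ σ.upper v, CDSweep.c * σ.portion (σ.Q P v) w) ∧
        CDSweep.cdIndex P = ∑ᶠ v ∈ CDSweep.vert P, σ.portion P v) := by
  refine ⟨?_, fun σ hσ => ⟨fun h0 => σ.exists_vert_eq_singleton hP h0, fun hdim =>
    ⟨fun v hv => σ.portion_eq hP hσ hdim hv, σ.cdIndex_eq_sum_portion hP hσ⟩⟩⟩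
  obtain ⟨φ, hφ⟩ := CDSweep.exists_cdToAB_eq_abIndex hP
  exact ⟨φ, hφ, fun ψ hψ => CDSweep.cdToAB_injective (hψ.trans hφ.symm)⟩
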